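/- Notation. For a bounded complex sequence $x=(x(k))_{k\ge 0}$ let $\mu(x)=(\mu(n,x))_{n\ge0}$, $\mu(n,x)=\inf\{s\ge 0:\ \#\{k:|x(k)|>s\}\le n\}$, be the decreasing rearrangement of $|x|$, and let $\Lambda_{\log}(\mathbb{Z}_+)$ be the space of all bounded sequences $x$ with $\sum_{n\ge0}\frac{\mu(n,x)}{n+1}<\infty$. For a bounded operator $A$ on the complex Hilbert space $L_2(-\pi,\pi)$ let $\mu(A)=(\mu(n,A))_{n\ge0}$, $\mu(n,A)=\inf\{\|A-R\|:\ \operatorname{rank}R\le n\}$, be its singular value sequence, and let $\Lambda_{\log}(B(L_2(-\pi,\pi)))$ be the ideal of all $A$ with $\|A\|_{\Lambda_{\log}}=\sum_{n\ge0}\frac{\mu(n,A)}{n+1}<\infty$. If $A$ is an integral operator with square-integrable kernel $K(t,s)$ on $(-\pi,\pi)^2$, its triangular truncation $T(A)$ is the integral operator with kernel $\operatorname{sgn}(t-s)K(t,s)$; $T$ is extended by continuity to an operator from $\Lambda_{\log}(B(L_2(-\pi,\pi)))$ to $B(L_2(-\pi,\pi))$ with the uniform norm, that is, $T(a)=\lim_j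 T(A_j)$ in the uniform norm whenever $A_j$ are Hilbert–Schmidt operators with $\|A_j-a\|_{\Lambda_{\log}}\to0$ for which the limit exists. Finally, $S_d=C_d+C_d^*$ is the discrete Calderón operator, $$(S_dy)(n)=\frac1{n+1}\sum_{k=0}^{n}y(k)+\sum_{k=n}^{\infty}\frac{y(k)}{k+1},\qquad n\ge0.$$ Theorem. For every $x\in\Lambda_{\log}(\mathbb{Z}_+)$ there exists $a\in B(L_2(-\pi,\pi))$ such that $\mu(a)=\mu(x)$, the triangular truncation $T(a)$ exists and is uniquely determined, and $$\mu(n,T(a))\ \ge\ \frac1{8\pi}\,\bigl(S_d\mu(x)\bigr)(n)\qquad\text{for all } n\ge0.$$ -/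

import Mathlib

open MeasureTheory Filter Topology
open scoped ENNReal

noncomputable section

namespace TriTrunc

/-! ### Sequences on `ℤ₊ = ℕ` -/

/-- The decreasing rearrangement of `|x|`, for a (bounded) sequence `x`:
`μ(n, x) = inf {s ≥ 0 : #{k : |x(k)| > s} ≤ n}`. -/
def seqMu (x : ℕ → ℂ) (n : ℕ) : ℝ :=
  sInf {s : ℝ | 0 ≤ s ∧ {k : ℕ | s < ‖x k‖}.encard ≤ (n : ℕ∞)}

/-- Membership in the Lorentz sequence space `Λ_log(ℤ₊)`: bounded sequences with
`∑ μ(n, x) / (n + 1) < ∞`. -/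
def MemLambdaLog (x : ℕ → ℂ) : Prop :=
  Memℓp x ∞ ∧ Summable fun n : ℕ => seqMu x n / ((n : ℝ) + 1)

/-- The discrete Cesàro (Hardy) operator `C_d`. -/
def cesaro (y : ℕ → ℝ) (n : ℕ) : ℝ :=
  1 / ((n : ℝ) + 1) * ∑ k ∈ Finset.range (n + 1), y k

/-- Its formal adjoint `C_d^*`: `(C_d^* y)(n) = ∑_{k ≥ n} y(k) / (k + 1)`. -/
def cesaroAdj (y : ℕ → ℝ) (n : ℕ) : ℝ :=
  ∑' j : ℕ, y (n + j) / (((n + j : ℕ) : ℝ) + 1)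

/-- The discrete Calderón operator `S_d = C_d + C_d^*`. -/
def calderon (y : ℕ → ℝ) (n : ℕ) : ℝ :=
  cesaro y n + cesaroAdj y n

/-! ### Operators on `L_2(-π, π)` -/

/-- Lebesgue measure on `(-π, π)`. -/
abbrev nu : Measure ℝ := volume.restrict (Set.Ioo (-Real.pi) Real.pi)

/-- The complex Hilbert space `L_2(-π, π)`. -/
abbrev H : Type := Lp ℂ 2 nu

/-- The `n`-th singular value (`n ≥ 0`, with multiplicity, in decreasing order) of a bounded
operator: `μ(n, A) = inf {‖A - R‖ : rank R ≤ n}`. -/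
def opMu (A : H →L[ℂ] H) (n : ℕ) : ℝ :=
  sInf {r : ℝ | ∃ R : H →L[ℂ] H,
    LinearMap.rank (R : H →ₗ[ℂ] H) ≤ (n : Cardinal) ∧ r = ‖A - R‖}

/-- The norm of the ideal `Λ_log(B(L_2(-π, π)))`, with value `∞` outside the ideal. -/
def lambdaLogNorm (A : H →L[ℂ] H) : ℝ≥0∞ :=
  ∑' n : ℕ, ENNReal.ofReal (opMu A n / ((n : ℝ) + 1))

/-- `A` is the integral operator with kernel `K`:
`(A f)(t) = ∫_{-π}^{π} K(t, s) f(s) ds` for almost every `t ∈ (-π, π)`. -/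
def IsIntegralOperator (K : ℝ → ℝ → ℂ) (A : H →L[ℂ] H) : Prop :=
  ∀ f : H, ∀ᵐ t ∂nu, A f t = ∫ s, K t s * f s ∂nu

/-- The truncated kernel `sgn(t - s) K(t, s)`. -/
def truncKernel (K : ℝ → ℝ → ℂ) (t s : ℝ) : ℂ :=
  ((Real.sign (t - s) : ℝ) : ℂ) * K t s

/-- Triangular truncation of a Hilbert–Schmidt integral operator: `A` has a square-integrable
kernel `K`, and `B` is the integral operator with kernel `sgn(t - s) K(t, s)`. -/
def IsKernelTruncation (A B : H →L[ℂ] H) : Prop :=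
  ∃ K : ℝ → ℝ → ℂ, MemLp (Function.uncurry K) 2 (nu.prod nu) ∧
    IsIntegralOperator K A ∧ IsIntegralOperator (truncKernel K) B

/-- `b = T(a)`, for the extension by continuity of triangular truncation from the
Hilbert–Schmidt integral operators to the ideal `Λ_log(B(L_2(-π, π)))`, as an operator into
`B(L_2(-π, π))` with the uniform norm: there are Hilbert–Schmidt operators `A_j` with
`A_j → a` in the norm of `Λ_log` and `T(A_j) → b` in the uniform norm. -/
def IsTriangularTruncation (a b : H →L[ℂ] H) : Prop :=
  ∃ A B : ℕ → (H →L[ℂ] H), (∀ j, IsKernelTruncation (A j) (B j)) ∧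
    Tendsto (fun j => lambdaLogNorm (A j - a)) atTop (𝓝 0) ∧
    Tendsto B atTop (𝓝 b)

end TriTrunc

end

noncomputable section

namespace TriTrunc

open scoped ComplexConjugate

/-! ### The decreasing rearrangement -/

/-! Let `y = seqMu x`, and let `a` be the convolution operator on the circle with Fourier multiplier
`y k` at `k ≥ 0` and `0` at negative frequencies; its singular values are `y`. For `|t - s| < 2π`
the function `π sgn(t - s) - (t - s)` is the 2π-periodic sawtooth, so multiplying a convolution
kernel by it gives another convolution kernel. Hence `π T(a) = [M, a] + R`, where `M` is
multiplication by `t` and `R` has the Fourier multiplier `-i ∑ y k / (m - k)`, a discrete Hilbert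
transform (`isDiag_truncKernel_sub_commutator`).

Since `a` kills the negative frequencies and its range avoids them, the commutator has zero
compression to them. There `π T(a)` compresses to the diagonal operator `R`, and for `-(n+1) ≤ m <
0` all terms of the Hilbert transform have one sign and add up to at least a quarter of `calderon y
n` in absolute value (`calderon_le_abs_hilbert`). These `n + 1` frequencies bound the `n`-th
singular value from below (`le_opMu_of_compression`).

Existence of `T(a)` follows by cutting `y` off at `j`: the errors are controlled by `tailNorm y j`,
uniformly in the frequency. Uniqueness says that truncation is closable: off-diagonal blocks of
`T(a)` are determined by `a`, and the diagonal blocks of a fine partition contribute nothing in the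
limit (`IsTriangularTruncation.unique`). -/

theorem seqMu_nonneg (x : ℕ → ℂ) (n : ℕ) : 0 ≤ seqMu x n :=
  Real.sInf_nonneg fun _ hs => hs.1

theorem antitone_seqMu {x : ℕ → ℂ} (hx : Memℓp x ∞) : Antitone (seqMu x) := by
  intro m n hmn
  obtain ⟨C, hC⟩ := memℓp_infty_iff.1 hx
  -- Boundedness makes the set for `m` nonempty; otherwise the default `sInf ∅ = 0` could break
  -- monotonicity.
  refine csInf_le_csInf ⟨0, fun _ hs => hs.1⟩ ⟨max C 0, le_max_right _ _, ?_⟩ ?_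
  · have : {k : ℕ | max C 0 < ‖x k‖} = ∅ := by
      ext k
      simpa using fun h : C < ‖x k‖ => absurd (hC ⟨k, rfl⟩) (not_le.2 h)
    rw [this]; simp
  · exact fun s hs => ⟨hs.1, hs.2.trans (by exact_mod_cast hmn)⟩

/-! ### Diagonal operators -/

section Diagonal

variable {ι E : Type*} [NormedAddCommGroup E] [InnerProductSpace ℂ E]

/-- `T` is the diagonal operator with eigenvalues `α` in the Hilbert basis `b`. -/
def IsDiag (b : HilbertBasis ι ℂ E) (α : ι → ℂ) (T : E →L[ℂ] E) : Prop :=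
  ∀ x i, b.repr (T x) i = α i * b.repr x i

theorem hilbertBasis_ext (b : HilbertBasis ι ℂ E) {x y : E}
    (h : ∀ i, b.repr x i = b.repr y i) : x = y :=
  b.repr.injective (lp.ext (funext h))

variable {b : HilbertBasis ι ℂ E} {α β : ι → ℂ} {S T : E →L[ℂ] E}

theorem IsDiag.sub (hS : IsDiag b α S) (hT : IsDiag b β T) :
    IsDiag b (fun i => α i - β i) (S - T) := by
  intro x i
  have h1 := hS x i
  have h2 := hT x i
  simp [h1, h2, sub_mul]

theorem IsDiag.apply_basis (hT : IsDiag b α T) (i : ι) : T (b i) = α i • b i := by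
  classical
  refine hilbertBasis_ext b fun j => ?_
  rw [hT]
  simp only [b.repr_self, map_smul, lp.coeFn_smul, Pi.smul_apply, lp.coeFn_single, smul_eq_mul]
  by_cases h : j = i
  · subst h; simp
  · simp [h]

theorem norm_le_of_repr_le {x y : E} {C : ℝ} (hC : 0 ≤ C)
    (h : ∀ i, ‖b.repr y i‖ ≤ C * ‖b.repr x i‖) : ‖y‖ ≤ C * ‖x‖ := by
  rw [← b.repr.norm_map y, ← b.repr.norm_map x]
  refine lp.norm_le_of_forall_sum_le (by norm_num) (by positivity) fun s => ?_
  have hs := lp.sum_rpow_le_norm_rpow (p := 2) (by norm_num) (b.repr x) s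
  simp only [ENNReal.toReal_ofNat, Real.rpow_ofNat] at hs ⊢
  calc ∑ i ∈ s, ‖b.repr y i‖ ^ 2 ≤ ∑ i ∈ s, C ^ 2 * ‖b.repr x i‖ ^ 2 := by
        refine Finset.sum_le_sum fun i _ => ?_
        rw [← mul_pow]
        exact pow_le_pow_left₀ (norm_nonneg _) (h i) 2
    _ = C ^ 2 * ∑ i ∈ s, ‖b.repr x i‖ ^ 2 := by rw [Finset.mul_sum]
    _ ≤ C ^ 2 * ‖b.repr x‖ ^ 2 := by gcongr
    _ = _ := by ring

theorem IsDiag.norm_le (hT : IsDiag b α T) {C : ℝ} (hC : 0 ≤ C) (hα : ∀ i, ‖α i‖ ≤ C) :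
    ‖T‖ ≤ C := by
  refine T.opNorm_le_bound hC fun x => norm_le_of_repr_le (b := b) hC fun i => ?_
  rw [hT, norm_mul]
  gcongr
  exact hα i

theorem exists_isDiag (b : HilbertBasis ι ℂ E) {C : ℝ} (hα : ∀ i, ‖α i‖ ≤ C) :
    ∃ T : E →L[ℂ] E, IsDiag b α T := by
  have hmem : ∀ x : E, Memℓp (fun i => α i * b.repr x i) 2 := by
    intro x
    have h1 : Memℓp (fun i => (C : ℂ) * b.repr x i) 2 := (lp.memℓp (b.repr x)).const_mul (C : ℂ)
    rw [memℓp_gen_iff (by norm_num)] at h1 ⊢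
    refine Summable.of_nonneg_of_le (fun i => by positivity) (fun i => ?_) h1
    refine Real.rpow_le_rpow (norm_nonneg _) ?_ (by norm_num)
    rw [norm_mul, norm_mul]
    refine mul_le_mul_of_nonneg_right ((hα i).trans ?_) (norm_nonneg _)
    rw [Complex.norm_real]
    exact Real.le_norm_self C
  let L : E →ₗ[ℂ] E :=
    { toFun := fun x => b.repr.symm ⟨fun i => α i * b.repr x i, hmem x⟩
      map_add' := fun x y => by
        refine hilbertBasis_ext b fun i => ?_
        simp only [map_add, LinearIsometryEquiv.apply_symm_apply, lp.coeFn_add, Pi.add_apply]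
        exact mul_add _ _ _
      map_smul' := fun c x => by
        refine hilbertBasis_ext b fun i => ?_
        simp [mul_left_comm] }
  have hL : ∀ x i, b.repr (L x) i = α i * b.repr x i := fun x i => by simp [L]
  refine ⟨L.mkContinuous (max C 0) fun x => ?_, fun x i => hL x i⟩
  refine norm_le_of_repr_le (b := b) (le_max_right _ _) fun i => ?_
  rw [hL, norm_mul]
  gcongr
  exact (hα i).trans (le_max_left _ _)

/-- Reduces diagonality to a computation on basis vectors. The bound on `α` supplies a bounded
diagonal operator to compare with on the dense span of the basis. -/
theorem isDiag_of_apply_basis (b : HilbertBasis ι ℂ E) {C : ℝ} (hα : ∀ i, ‖α i‖ ≤ C)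
    (h : ∀ i, T (b i) = α i • b i) : IsDiag b α T := by
  obtain ⟨S, hS⟩ := exists_isDiag b hα
  have : T = S := by
    refine ContinuousLinearMap.ext_on (s := Set.range b) ?_ ?_
    · exact Submodule.dense_iff_topologicalClosure_eq_top.2 b.dense_span
    · rintro _ ⟨i, rfl⟩
      rw [h, hS.apply_basis]
  rwa [this]

theorem exists_rank_le_isDiag_sub [DecidableEq ι] (hT : IsDiag b α T) (s : Finset ι) :
    ∃ R : E →L[ℂ] E, LinearMap.rank (R : E →ₗ[ℂ] E) ≤ (s.card : Cardinal) ∧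
      IsDiag b (fun i => if i ∈ s then 0 else α i) (T - R) := by
  classical
  let R : E →L[ℂ] E := ∑ i ∈ s, α i • (innerSL ℂ (b i)).smulRight (b i)
  have hR : ∀ x, R x = ∑ i ∈ s, (α i * b.repr x i) • b i := by
    intro x
    simp [R, b.repr_apply_apply, smul_smul]
  refine ⟨R, ?_, ?_⟩
  · have hle : LinearMap.range (R : E →ₗ[ℂ] E) ≤ Submodule.span ℂ (s.image b : Set E) := by
      rintro _ ⟨x, rfl⟩
      simp only [ContinuousLinearMap.coe_coe, hR]
      refine Submodule.sum_mem _ fun i hi => Submodule.smul_mem _ _ (Submodule.subset_span ?_)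
      simpa using ⟨i, hi, rfl⟩
    have hcard : (s.image b).card ≤ s.card := Finset.card_image_le
    exact (Submodule.rank_mono hle).trans
      ((rank_span_finset_le _).trans (Nat.cast_le.2 hcard))
  · intro x j
    have h1 := hT x j
    have h2 : b.repr (R x) j = if j ∈ s then α j * b.repr x j else 0 := by
      rw [hR, b.repr_apply_apply, inner_sum]
      simp only [inner_smul_right, orthonormal_iff_ite.1 b.orthonormal]
      simp
    rw [sub_apply, map_sub, lp.coeFn_sub, Pi.sub_apply, h1, h2]
    by_cases hj : j ∈ s <;> simp [hj]

end Diagonal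

/-! ### Singular values -/

theorem opMu_le {A R : H →L[ℂ] H} {n : ℕ} (hR : LinearMap.rank (R : H →ₗ[ℂ] H) ≤ (n : Cardinal)) :
    opMu A n ≤ ‖A - R‖ := by
  refine csInf_le ⟨0, ?_⟩ ⟨R, hR, rfl⟩
  rintro _ ⟨R, _, rfl⟩
  exact norm_nonneg _

theorem le_opMu {A : H →L[ℂ] H} {n : ℕ} {c : ℝ}
    (h : ∀ R : H →L[ℂ] H, LinearMap.rank (R : H →ₗ[ℂ] H) ≤ (n : Cardinal) → c ≤ ‖A - R‖) :
    c ≤ opMu A n := by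
  refine le_csInf ⟨_, 0, ?_, rfl⟩ ?_
  · have : ((0 : H →L[ℂ] H) : H →ₗ[ℂ] H) = 0 := rfl
    rw [this, LinearMap.rank_zero]
    exact zero_le
  · rintro _ ⟨R, hR, rfl⟩
    exact h R hR

theorem norm_le_opMu_zero (A : H →L[ℂ] H) : ‖A‖ ≤ opMu A 0 := by
  refine le_opMu fun R hR => ?_
  have h0 : (R : H →ₗ[ℂ] H) = 0 := by
    have h1 : Module.rank ℂ (LinearMap.range (R : H →ₗ[ℂ] H)) = 0 :=
      le_antisymm (by simpa using hR) zero_le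
    rw [rank_zero_iff_forall_zero] at h1
    ext1 x
    exact congrArg Subtype.val (h1 ⟨_, LinearMap.mem_range_self _ x⟩)
  have : R = 0 := by
    ext1 x
    exact LinearMap.congr_fun h0 x
  simp [this]

/-- The term `n = 0` of the series alone dominates the uniform norm. -/
theorem norm_le_lambdaLogNorm (A : H →L[ℂ] H) : ENNReal.ofReal ‖A‖ ≤ lambdaLogNorm A := by
  refine le_trans (ENNReal.ofReal_le_ofReal ?_) (ENNReal.le_tsum 0)
  simpa using norm_le_opMu_zero A

variable {ι : Type} {b : HilbertBasis ι ℂ H} {α : ι → ℂ}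

theorem IsDiag.opMu_le {T : H →L[ℂ] H} (hT : IsDiag b α T) {n : ℕ} (s : Finset ι)
    (hs : s.card ≤ n) {C : ℝ} (hC : 0 ≤ C) (hα : ∀ i ∉ s, ‖α i‖ ≤ C) : opMu T n ≤ C := by
  classical
  obtain ⟨R, hR, hTR⟩ := exists_rank_le_isDiag_sub hT s
  refine (TriTrunc.opMu_le (hR.trans (by exact_mod_cast hs))).trans (hTR.norm_le hC fun i => ?_)
  by_cases h : i ∈ s
  · simpa [h] using hC
  · simpa [h] using hα i h

/-- If the compression of `T` to the span of `n + 1` basis vectors is diagonal with eigenvalues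
of absolute value at least `c`, then `μ(n, T) ≥ c`. -/
theorem le_opMu_of_compression {T : H →L[ℂ] H} {n : ℕ} (s : Finset ι)
    (hs : s.card = n + 1) {c : ℝ} (hα : ∀ i ∈ s, c ≤ ‖α i‖)
    (hT : ∀ i ∈ s, ∀ j ∈ s, b.repr (T (b i)) j = α i * b.repr (b i) j) : c ≤ opMu T n := by
  classical
  rcases le_or_gt c 0 with hc | hc
  · exact hc.trans (le_opMu fun R _ => norm_nonneg _)
  refine le_opMu fun R hR => ?_
  let Φ : (s → ℂ) →ₗ[ℂ] H := Fintype.linearCombination ℂ (fun i : s => b i)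
  have hΦ : ∀ w, Φ w = ∑ i : s, w i • b i := fun w => Fintype.linearCombination_apply _ _ _
  -- Dimension count: an operator of rank at most `n` has a kernel on the `(n + 1)`-dimensional
  -- span.
  obtain ⟨w, hw, hw0⟩ : ∃ w : s → ℂ, R (Φ w) = 0 ∧ w ≠ 0 := by
    have hrank : LinearMap.rank ((R : H →ₗ[ℂ] H) ∘ₗ Φ) ≤ n :=
      (LinearMap.rank_comp_le_left _ _).trans hR
    have hadd := LinearMap.rank_range_add_rank_ker ((R : H →ₗ[ℂ] H) ∘ₗ Φ)
    by_contra! hcon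
    have hker : LinearMap.ker ((R : H →ₗ[ℂ] H) ∘ₗ Φ) = ⊥ :=
      LinearMap.ker_eq_bot'.2 fun w hw => hcon w hw
    rw [hker, rank_bot, add_zero, rank_fun', Fintype.card_coe, hs] at hadd
    rw [LinearMap.rank, hadd] at hrank
    have : n + 1 ≤ n := by exact_mod_cast hrank
    omega
  have hrepr : ∀ j : s, b.repr (Φ w) j = w j := by
    intro j
    rw [hΦ, b.repr_apply_apply, inner_sum]
    simp only [inner_smul_right, orthonormal_iff_ite.1 b.orthonormal]
    simp
  have hTrepr : ∀ j : s, b.repr (T (Φ w)) j = α j * w j := by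
    intro j
    rw [hΦ, map_sum, map_sum, lp.coeFn_sum, Finset.sum_apply]
    simp only [map_smul, lp.coeFn_smul, Pi.smul_apply, smul_eq_mul]
    rw [Finset.sum_congr rfl fun i _ => by rw [hT i i.2 j j.2]]
    simp only [b.repr_apply_apply, orthonormal_iff_ite.1 b.orthonormal]
    simp [mul_comm]
  have hnorm : ‖Φ w‖ ^ 2 = ∑ j : s, ‖w j‖ ^ 2 := by
    have h1 : (‖Φ w‖ : ℂ) ^ 2 = ∑ j : s, (‖w j‖ : ℂ) ^ 2 := by
      have h2 := inner_self_eq_norm_sq_to_K (𝕜 := ℂ) (Φ w)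
      rw [show ((‖Φ w‖ : ℂ)) ^ 2 = inner ℂ (Φ w) (Φ w) from h2.symm]
      conv_lhs => enter [2]; rw [hΦ]
      rw [sum_inner]
      refine Finset.sum_congr rfl fun j _ => ?_
      rw [inner_smul_left, ← b.repr_apply_apply, hrepr, ← Complex.conj_mul']
    exact_mod_cast h1
  have hpos : 0 < ‖Φ w‖ := by
    obtain ⟨j, hj⟩ := Function.ne_iff.1 hw0
    have h : ‖Φ w‖ ^ 2 ≠ 0 := by
      rw [hnorm]
      refine (Finset.sum_pos' (fun _ _ => by positivity) ⟨j, Finset.mem_univ _, ?_⟩).ne'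
      have : 0 < ‖w j‖ := norm_pos_iff.2 hj
      positivity
    exact (norm_nonneg _).lt_of_ne' fun h0 => h (by rw [h0]; norm_num)
  -- Only the coordinates of `T (Φ w)` inside `s` are known; Bessel's inequality discards the
  -- others.
  have hbessel : ∑ j : s, ‖α j * w j‖ ^ 2 ≤ ‖T (Φ w)‖ ^ 2 := by
    have h := lp.sum_rpow_le_norm_rpow (p := 2) (by norm_num) (b.repr (T (Φ w))) s
    simp only [ENNReal.toReal_ofNat, Real.rpow_ofNat, LinearIsometryEquiv.norm_map] at h
    rw [← Finset.sum_coe_sort] at h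
    simpa only [hTrepr] using h
  have hlow : (c * ‖Φ w‖) ^ 2 ≤ ‖T (Φ w)‖ ^ 2 := by
    refine le_trans ?_ hbessel
    rw [mul_pow, hnorm, Finset.mul_sum]
    refine Finset.sum_le_sum fun j _ => ?_
    rw [norm_mul, mul_pow]
    gcongr
    exact hα j j.2
  have hle : c * ‖Φ w‖ ≤ ‖T (Φ w)‖ := (sq_le_sq₀ (by positivity) (norm_nonneg _)).1 hlow
  have : T (Φ w) = (T - R) (Φ w) := by simp [hw]
  rw [this] at hle
  exact le_of_mul_le_mul_right (hle.trans ((T - R).le_opNorm _)) hpos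

/-! ### Triangular truncation is closable -/

/-- The `i`-th cell of the partition of the line into half-open intervals of length `1 / N`. -/
def cell (N : ℕ) (i : ℤ) : Set ℝ := {t | ⌊(N : ℝ) * t⌋ = i}

theorem measurableSet_cell (N : ℕ) (i : ℤ) : MeasurableSet (cell N i) :=
  (measurable_const.mul measurable_id).floor (measurableSet_singleton i)

/-- The restriction of `f` to the cell `i`. -/
def piece (N : ℕ) (i : ℤ) (f : H) : H :=
  ((Lp.memLp f).indicator (measurableSet_cell N i)).toLp _

theorem piece_ae (N : ℕ) (i : ℤ) (f : H) : piece N i f =ᵐ[nu] (cell N i).indicator f :=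
  MemLp.coeFn_toLp _

/-- The indices of the cells that meet `(-π, π)`. -/
def cellIndices (N : ℕ) : Finset ℤ := Finset.Icc (-(4 * N : ℤ)) (4 * N)

theorem floor_mem_cellIndices {N : ℕ} {t : ℝ} (ht : t ∈ Set.Ioo (-Real.pi) Real.pi) :
    ⌊(N : ℝ) * t⌋ ∈ cellIndices N := by
  have h4 := Real.pi_le_four
  have hN : (0 : ℝ) ≤ N := N.cast_nonneg
  rw [cellIndices, Finset.mem_Icc]
  refine ⟨Int.le_floor.2 ?_, ?_⟩
  · push_cast
    nlinarith [ht.1]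
  · have : ((⌊(N : ℝ) * t⌋ : ℤ) : ℝ) ≤ ((4 * N : ℤ) : ℝ) := by
      refine (Int.floor_le _).trans ?_
      push_cast
      nlinarith [ht.2]
    exact_mod_cast this

theorem ae_mem_Ioo : ∀ᵐ t ∂nu, t ∈ Set.Ioo (-Real.pi) Real.pi :=
  ae_restrict_mem measurableSet_Ioo

theorem sum_piece (N : ℕ) (f : H) : ∑ i ∈ cellIndices N, piece N i f = f := by
  refine Lp.ext ?_
  have h : ∀ᵐ t ∂nu, ∀ i ∈ cellIndices N, piece N i f t = (cell N i).indicator f t :=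
    (Finset.eventually_all _).2 fun i _ => piece_ae N i f
  filter_upwards [Lp.coeFn_finsetSum (cellIndices N) (fun i => piece N i f), h,
    ae_mem_Ioo] with t ht h1 ht'
  rw [ht, Finset.sum_apply, Finset.sum_congr rfl h1]
  rw [Finset.sum_eq_single_of_mem _ (floor_mem_cellIndices ht')]
  · exact Set.indicator_of_mem (by rfl) _
  · intro j _ hj
    exact Set.indicator_of_notMem (fun h => hj h.symm) _

theorem inner_piece (N : ℕ) (i : ℤ) (f g : H) :
    inner ℂ (piece N i f) g = inner ℂ (piece N i f) (piece N i g) := by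
  rw [L2.inner_def, L2.inner_def]
  refine integral_congr_ae ?_
  filter_upwards [piece_ae N i f, piece_ae N i g] with t h1 h2
  rw [h1, h2]
  by_cases ht : t ∈ cell N i <;> simp [ht]

theorem sum_norm_piece_sq (N : ℕ) (f : H) :
    ∑ i ∈ cellIndices N, ‖piece N i f‖ ^ 2 = ‖f‖ ^ 2 := by
  have h : (‖f‖ : ℂ) ^ 2 = ∑ i ∈ cellIndices N, (‖piece N i f‖ : ℂ) ^ 2 := by
    have h2 := fun f : H => inner_self_eq_norm_sq_to_K (𝕜 := ℂ) f
    rw [show (‖f‖ : ℂ) ^ 2 = inner ℂ f f from (h2 f).symm]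
    conv_lhs => enter [2]; rw [← sum_piece N f]
    rw [sum_inner]
    exact Finset.sum_congr rfl fun i _ => (inner_piece N i f f).trans (h2 _)
  exact_mod_cast h.symm

/-- The trace of the form of `B` on the diagonal blocks of the partition with mesh `1 / N`. -/
def diagonalSum (B : H →L[ℂ] H) (f g : H) (N : ℕ) : ℂ :=
  ∑ i ∈ cellIndices N, inner ℂ (piece N i g) (B (piece N i f))

/-- Cauchy–Schwarz over the orthogonal pieces. Uniformity in `N` is what lets vanishing of the
diagonal sums survive uniform limits of operators. -/
theorem norm_diagonalSum_le (B : H →L[ℂ] H) (f g : H) (N : ℕ) :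
    ‖diagonalSum B f g N‖ ≤ ‖B‖ * (‖f‖ * ‖g‖) := by
  calc ‖diagonalSum B f g N‖ ≤ ∑ i ∈ cellIndices N, ‖B‖ * (‖piece N i f‖ * ‖piece N i g‖) := by
        refine (norm_sum_le _ _).trans (Finset.sum_le_sum fun i _ => ?_)
        calc _ ≤ ‖piece N i g‖ * ‖B (piece N i f)‖ := norm_inner_le_norm _ _
          _ ≤ ‖piece N i g‖ * (‖B‖ * ‖piece N i f‖) := by gcongr; exact B.le_opNorm _
          _ = _ := by ring
    _ = ‖B‖ * ∑ i ∈ cellIndices N, ‖piece N i f‖ * ‖piece N i g‖ := by rw [Finset.mul_sum]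
    _ ≤ _ := by
        gcongr
        refine (Real.sum_mul_le_sqrt_mul_sqrt _ _ _).trans ?_
        rw [sum_norm_piece_sq, sum_norm_piece_sq, Real.sqrt_sq (norm_nonneg _),
          Real.sqrt_sq (norm_nonneg _)]

theorem diagonalSum_sub (B B' : H →L[ℂ] H) (f g : H) (N : ℕ) :
    diagonalSum (B - B') f g N = diagonalSum B f g N - diagonalSum B' f g N := by
  simp [diagonalSum, inner_sub_right]

theorem tendsto_diagonalSum_of_tendsto {B : ℕ → H →L[ℂ] H} {b : H →L[ℂ] H} {f g : H}
    (hB : ∀ j, Tendsto (diagonalSum (B j) f g) atTop (𝓝 0)) (hb : Tendsto B atTop (𝓝 b)) :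
    Tendsto (diagonalSum b f g) atTop (𝓝 0) := by
  rw [Metric.tendsto_atTop]
  intro ε hε
  have h1 : Tendsto (fun j => ‖b - B j‖ * (‖f‖ * ‖g‖)) atTop (𝓝 0) := by
    have : Tendsto (fun j => ‖b - B j‖) atTop (𝓝 0) := by
      simpa using (tendsto_const_nhds (x := b) |>.sub hb).norm
    simpa using this.mul_const (‖f‖ * ‖g‖)
  obtain ⟨j, hj⟩ := (h1.eventually (gt_mem_nhds (half_pos hε))).exists
  obtain ⟨N₀, hN₀⟩ := Metric.tendsto_atTop.1 (hB j) (ε / 2) (half_pos hε)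
  refine ⟨N₀, fun N hN => ?_⟩
  have h2 := hN₀ N hN
  rw [dist_zero_right] at h2 ⊢
  have h3 := norm_diagonalSum_le (b - B j) f g N
  rw [diagonalSum_sub] at h3
  have h4 := norm_sub_norm_le (diagonalSum b f g N) (diagonalSum (B j) f g N)
  linarith

theorem measurable_sign : Measurable Real.sign := by
  unfold Real.sign
  exact Measurable.ite measurableSet_Iio measurable_const
    (Measurable.ite measurableSet_Ioi measurable_const measurable_const)

theorem norm_sign_le (r : ℝ) : ‖((Real.sign r : ℝ) : ℂ)‖ ≤ 1 := by
  rcases Real.sign_apply_eq r with h | h | h <;> simp [h]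

theorem memLp_truncKernel {K : ℝ → ℝ → ℂ} (hK : MemLp (Function.uncurry K) 2 (nu.prod nu)) :
    MemLp (Function.uncurry (truncKernel K)) 2 (nu.prod nu) := by
  refine hK.of_le ?_ (ae_of_all _ fun p => ?_)
  · refine AEStronglyMeasurable.mul ?_ hK.1
    exact (Complex.measurable_ofReal.comp
      (measurable_sign.comp (measurable_fst.sub measurable_snd))).aestronglyMeasurable
  · simp only [Function.uncurry, truncKernel, norm_mul]
    exact mul_le_of_le_one_left (norm_nonneg _) (norm_sign_le _)

theorem integrable_kernel_mul {K : ℝ → ℝ → ℂ} (hK : MemLp (Function.uncurry K) 2 (nu.prod nu))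
    (f g : H) : Integrable (fun p : ℝ × ℝ => conj (g p.1) * (K p.1 p.2 * f p.2)) (nu.prod nu) := by
  have hfg : MemLp (fun p : ℝ × ℝ => conj (g p.1) * f p.2) 2 (nu.prod nu) := by
    have hm : AEStronglyMeasurable (fun p : ℝ × ℝ => conj (g p.1) * f p.2) (nu.prod nu) :=
      (RCLike.continuous_conj.comp_aestronglyMeasurable (Lp.aestronglyMeasurable g).comp_fst).mul
        (Lp.aestronglyMeasurable f).comp_snd
    rw [memLp_two_iff_integrable_sq_norm hm]
    have := (Lp.memLp g).integrable_norm_pow two_ne_zero |>.mul_prod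
      ((Lp.memLp f).integrable_norm_pow two_ne_zero)
    refine this.congr (ae_of_all _ fun p => ?_)
    simp [mul_pow]
  refine (hK.integrable_mul hfg).congr (ae_of_all _ fun p => ?_)
  simp only [Function.uncurry, Pi.mul_apply]
  ring

/-- The diagonal sum is the integral of `conj g(t) K(t,s) f(s)` over the union of the squares `cell
× cell`. These shrink to the diagonal, where the integrand is zero, and dominated convergence
applies. -/
theorem IsIntegralOperator.tendsto_diagonalSum {K : ℝ → ℝ → ℂ} {B : H →L[ℂ] H}
    (hK : MemLp (Function.uncurry K) 2 (nu.prod nu)) (hB : IsIntegralOperator K B)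
    (hdiag : ∀ t, K t t = 0) (f g : H) : Tendsto (diagonalSum B f g) atTop (𝓝 0) := by
  set F : ℝ × ℝ → ℂ := fun p => conj (g p.1) * (K p.1 p.2 * f p.2) with hF
  have hFint : Integrable F (nu.prod nu) := integrable_kernel_mul hK f g
  have hcell : ∀ N i, MeasurableSet (cell N i ×ˢ cell N i) := fun N i =>
    (measurableSet_cell N i).prod (measurableSet_cell N i)
  have hterm : ∀ N i, inner ℂ (piece N i g) (B (piece N i f)) =
      ∫ p, (cell N i ×ˢ cell N i).indicator F p ∂(nu.prod nu) := by
    intro N i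
    rw [integral_prod _ (hFint.indicator (hcell N i)), L2.inner_def]
    refine integral_congr_ae ?_
    filter_upwards [piece_ae N i g, hB (piece N i f)] with t h1 h2
    rw [h1, h2]
    have h3 : ∫ s, K t s * piece N i f s ∂nu = ∫ s, K t s * (cell N i).indicator f s ∂nu :=
      integral_congr_ae ((piece_ae N i f).mono fun s hs => by simp only [hs])
    rw [h3, RCLike.inner_apply', ← integral_const_mul]
    refine integral_congr_ae (ae_of_all _ fun s => ?_)
    by_cases ht : t ∈ cell N i <;> by_cases hs : s ∈ cell N i <;>
      simp [Set.indicator, ht, hs, hF]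
  let E : ℕ → Set (ℝ × ℝ) := fun N => {p | ⌊(N : ℝ) * p.1⌋ = ⌊(N : ℝ) * p.2⌋}
  have hE : ∀ N, MeasurableSet (E N) := fun N =>
    measurableSet_eq_fun (measurable_const.mul measurable_fst).floor
      (measurable_const.mul measurable_snd).floor
  have hae : ∀ᵐ p ∂(nu.prod nu), p.1 ∈ Set.Ioo (-Real.pi) Real.pi :=
    Measure.quasiMeasurePreserving_fst.ae ae_mem_Ioo
  have hsum : ∀ N, diagonalSum B f g N = ∫ p, (E N).indicator F p ∂(nu.prod nu) := by
    intro N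
    rw [diagonalSum, Finset.sum_congr rfl fun i _ => hterm N i,
      ← integral_finsetSum _ fun i _ => hFint.indicator (hcell N i)]
    refine integral_congr_ae ?_
    filter_upwards [hae] with p hp
    rw [Finset.sum_eq_single_of_mem _ (floor_mem_cellIndices hp)]
    · refine Set.indicator_eq_indicator ?_ rfl
      simp only [Set.mem_prod, cell, E]
      exact ⟨fun h => h.2.symm, fun h => ⟨rfl, h.symm⟩⟩
    · intro j _ hj
      exact Set.indicator_of_notMem (fun h => hj h.1.symm) _
  rw [show diagonalSum B f g = fun N => ∫ p, (E N).indicator F p ∂(nu.prod nu) from funext hsum]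
  have hlim : ∀ p : ℝ × ℝ, Tendsto (fun N => (E N).indicator F p) atTop (𝓝 0) := by
    intro p
    by_cases hp : p.1 = p.2
    · have : F p = 0 := by simp [hF, ← hp, hdiag]
      have h0 : ∀ N, (E N).indicator F p = 0 := fun N => by
        rw [Set.indicator_apply, this, ite_self]
      simp [h0]
    · refine tendsto_const_nhds.congr' ?_
      have hpos : 0 < |p.1 - p.2| := abs_pos.2 (sub_ne_zero.2 hp)
      obtain ⟨N₀, hN₀⟩ := exists_nat_gt (1 / |p.1 - p.2|)
      filter_upwards [eventually_ge_atTop N₀] with N hN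
      refine (Set.indicator_of_notMem (fun h => ?_) _).symm
      -- Points sharing a cell satisfy `N |p.1 - p.2| < 1`, which fails for large `N`.
      have h1 := Int.abs_sub_lt_one_of_floor_eq_floor h
      rw [← mul_sub, abs_mul, Nat.abs_cast] at h1
      rw [div_lt_iff₀ hpos] at hN₀
      have : (N₀ : ℝ) * |p.1 - p.2| ≤ N * |p.1 - p.2| := by gcongr
      linarith
  have := tendsto_integral_of_dominated_convergence (μ := nu.prod nu)
    (F := fun N => (E N).indicator F) (f := fun _ => 0) (fun p => ‖F p‖)
    (fun N => (hFint.1.indicator (hE N))) hFint.norm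
    (fun N => ae_of_all _ fun p => norm_indicator_le_norm_self _ _)
    (ae_of_all _ hlim)
  simpa using this

/-- On a product of two distinct cells `sgn(t - s)` is constant, so truncation only multiplies the
block by a sign. -/
theorem inner_piece_truncation {K : ℝ → ℝ → ℂ} {A B : H →L[ℂ] H} (hA : IsIntegralOperator K A)
    (hB : IsIntegralOperator (truncKernel K) B) (N : ℕ) {i k : ℤ} (hik : i ≠ k) (f g : H) :
    inner ℂ (piece N k g) (B (piece N i f)) =
      ((Real.sign ((k : ℝ) - i) : ℝ) : ℂ) * inner ℂ (piece N k g) (A (piece N i f)) := by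
  have hN : (0 : ℝ) ≤ N := N.cast_nonneg
  have hsign : ∀ t ∈ cell N k, ∀ s ∈ cell N i, Real.sign (t - s) = Real.sign ((k : ℝ) - i) := by
    rintro t rfl s rfl
    rcases lt_or_gt_of_ne hik with h | h
    · have h1 : s < t := lt_of_mul_lt_mul_left (Int.floor_mono.reflect_lt h) hN
      rw [Real.sign_of_pos (sub_pos.2 h1), Real.sign_of_pos (sub_pos.2 (by exact_mod_cast h))]
    · have h1 : t < s := lt_of_mul_lt_mul_left (Int.floor_mono.reflect_lt h) hN
      rw [Real.sign_of_neg (sub_neg.2 h1), Real.sign_of_neg (sub_neg.2 (by exact_mod_cast h))]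
  rw [L2.inner_def, L2.inner_def, ← integral_const_mul]
  refine integral_congr_ae ?_
  filter_upwards [piece_ae N k g, hA (piece N i f), hB (piece N i f)] with t h1 h2 h3
  rw [h1, h2, h3]
  by_cases ht : t ∈ cell N k
  · have h4 : ∫ s, truncKernel K t s * piece N i f s ∂nu =
        ((Real.sign ((k : ℝ) - i) : ℝ) : ℂ) * ∫ s, K t s * piece N i f s ∂nu := by
      rw [← integral_const_mul]
      refine integral_congr_ae ((piece_ae N i f).mono fun s hs => ?_)
      simp only [hs, truncKernel]
      by_cases hs' : s ∈ cell N i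
      · rw [hsign t ht s hs', mul_assoc]
      · simp [hs']
    rw [h4, RCLike.inner_apply', RCLike.inner_apply']
    ring
  · simp [ht]

theorem tendsto_of_lambdaLogNorm {A : ℕ → H →L[ℂ] H} {a : H →L[ℂ] H}
    (h : Tendsto (fun j => lambdaLogNorm (A j - a)) atTop (𝓝 0)) : Tendsto A atTop (𝓝 a) := by
  rw [tendsto_iff_norm_sub_tendsto_zero]
  have h1 : Tendsto (fun j => ENNReal.ofReal ‖A j - a‖) atTop (𝓝 0) :=
    tendsto_of_tendsto_of_tendsto_of_le_of_le tendsto_const_nhds h (fun _ => zero_le)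
      fun j => norm_le_lambdaLogNorm _
  have h2 := (ENNReal.tendsto_toReal ENNReal.zero_ne_top).comp h1
  simpa [Function.comp_def, ENNReal.toReal_ofReal] using h2

theorem IsTriangularTruncation.inner_piece {a b : H →L[ℂ] H} (h : IsTriangularTruncation a b)
    (N : ℕ) {i k : ℤ} (hik : i ≠ k) (f g : H) :
    inner ℂ (piece N k g) (b (piece N i f)) =
      ((Real.sign ((k : ℝ) - i) : ℝ) : ℂ) * inner ℂ (piece N k g) (a (piece N i f)) := by
  obtain ⟨A, B, hAB, hA, hB⟩ := h
  have hlim : ∀ {T : ℕ → H →L[ℂ] H} {t : H →L[ℂ] H}, Tendsto T atTop (𝓝 t) →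
      Tendsto (fun j => inner ℂ (piece N k g) (T j (piece N i f))) atTop
        (𝓝 (inner ℂ (piece N k g) (t (piece N i f)))) := fun hT =>
    tendsto_const_nhds.inner
      (((ContinuousLinearMap.apply ℂ H (piece N i f)).continuous.tendsto _).comp hT)
  refine tendsto_nhds_unique (hlim hB) ?_
  refine ((hlim (tendsto_of_lambdaLogNorm hA)).const_mul _).congr fun j => ?_
  obtain ⟨K, _, hKA, hKB⟩ := hAB j
  exact (inner_piece_truncation hKA hKB N hik f g).symm

theorem IsTriangularTruncation.tendsto_diagonalSum {a b : H →L[ℂ] H}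
    (h : IsTriangularTruncation a b) (f g : H) : Tendsto (diagonalSum b f g) atTop (𝓝 0) := by
  obtain ⟨A, B, hAB, -, hB⟩ := h
  refine tendsto_diagonalSum_of_tendsto (fun j => ?_) hB
  obtain ⟨K, hK, _, hKB⟩ := hAB j
  exact hKB.tendsto_diagonalSum (memLp_truncKernel hK) (fun t => by simp [truncKernel]) f g

/-- Two truncations of `a` have the same off-diagonal blocks, so the whole form of `b - b'` equals
its diagonal sum at every mesh; that sum tends to zero. -/
theorem IsTriangularTruncation.unique {a b b' : H →L[ℂ] H} (h : IsTriangularTruncation a b)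
    (h' : IsTriangularTruncation a b') : b = b' := by
  refine ContinuousLinearMap.ext fun f => ext_inner_left ℂ fun g => ?_
  rw [← sub_eq_zero, ← inner_sub_right, ← sub_apply]
  have hconst : ∀ N, diagonalSum (b - b') f g N = inner ℂ g ((b - b') f) := by
    intro N
    conv_rhs => rw [← sum_piece N f, ← sum_piece N g, map_sum, inner_sum]
    refine Finset.sum_congr rfl fun i hi => ?_
    rw [sum_inner, Finset.sum_eq_single_of_mem i hi]
    intro k _ hk
    rw [sub_apply, inner_sub_right, h.inner_piece N hk.symm, h'.inner_piece N hk.symm, sub_self]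
  have h0 : Tendsto (diagonalSum (b - b') f g) atTop (𝓝 0) := by
    have := (h.tendsto_diagonalSum f g).sub (h'.tendsto_diagonalSum f g)
    rw [sub_zero] at this
    exact this.congr fun N => (diagonalSum_sub b b' f g N).symm
  rw [show diagonalSum (b - b') f g = fun _ => inner ℂ g ((b - b') f) from funext hconst] at h0
  exact tendsto_nhds_unique tendsto_const_nhds h0

/-! ### The Fourier basis of `L_2(-π, π)` -/

/-- The character `t ↦ e^{imt}`. -/
def expChar (m : ℤ) (t : ℝ) : ℂ := Complex.exp (m * t * Complex.I)

theorem expChar_add (m n : ℤ) (t : ℝ) : expChar (m + n) t = expChar m t * expChar n t := by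
  rw [expChar, expChar, expChar, ← Complex.exp_add]
  push_cast
  ring_nf

theorem expChar_sub_right (m : ℤ) (t s : ℝ) :
    expChar m (t - s) = expChar m t * expChar (-m) s := by
  rw [expChar, expChar, expChar, ← Complex.exp_add]
  push_cast
  ring_nf

theorem expChar_zero (t : ℝ) : expChar 0 t = 1 := by simp [expChar]

theorem norm_expChar (m : ℤ) (t : ℝ) : ‖expChar m t‖ = 1 := by
  have := Complex.norm_exp_ofReal_mul_I (m * t)
  push_cast at this
  exact this

theorem conj_expChar (m : ℤ) (t : ℝ) : conj (expChar m t) = expChar (-m) t := by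
  rw [expChar, expChar, ← Complex.exp_conj]
  simp

theorem continuous_expChar (m : ℤ) : Continuous (expChar m) := by
  unfold expChar
  fun_prop

theorem hasDerivAt_expChar (m : ℤ) (t : ℝ) :
    HasDerivAt (expChar m) (m * Complex.I * expChar m t) t := by
  have h : HasDerivAt (fun t : ℝ => (m : ℂ) * t * Complex.I) (m * 1 * Complex.I) t :=
    ((Complex.ofRealCLM.hasDerivAt (x := t)).const_mul (m : ℂ)).mul_const Complex.I
  refine h.cexp.congr_deriv ?_
  rw [expChar]
  ring

theorem expChar_neg_pi (m : ℤ) : expChar m (-Real.pi) = expChar m Real.pi := by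
  rw [expChar, expChar, Complex.exp_eq_exp_iff_exists_int]
  refine ⟨-m, ?_⟩
  push_cast
  ring

theorem integral_nu (f : ℝ → ℂ) : ∫ t, f t ∂nu = ∫ t in (-Real.pi)..Real.pi, f t := by
  rw [intervalIntegral.integral_of_le (by linarith [Real.pi_pos]), integral_Ioc_eq_integral_Ioo]

theorem integral_expChar (m : ℤ) :
    ∫ t, expChar m t ∂nu = if m = 0 then (2 * Real.pi : ℂ) else 0 := by
  rw [integral_nu]
  split_ifs with hm
  · subst hm
    simp only [expChar_zero, intervalIntegral.integral_const]
    rw [Complex.real_smul]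
    push_cast
    ring
  · have hmI : (m : ℂ) * Complex.I ≠ 0 := mul_ne_zero (by exact_mod_cast hm) Complex.I_ne_zero
    rw [intervalIntegral.integral_eq_sub_of_hasDerivAt
      (f := fun t => (m * Complex.I)⁻¹ * expChar m t)]
    · rw [expChar_neg_pi, sub_self]
    · intro t _
      refine ((hasDerivAt_expChar m t).const_mul ((m : ℂ) * Complex.I)⁻¹).congr_deriv ?_
      rw [← mul_assoc, inv_mul_cancel₀ hmI, one_mul]
    · exact (continuous_expChar m).intervalIntegrable _ _

theorem memLp_expChar (m : ℤ) : MemLp (expChar m) 2 nu :=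
  MemLp.of_bound (continuous_expChar m).aestronglyMeasurable 1
    (ae_of_all _ fun t => (norm_expChar m t).le)

/-- The character `t ↦ e^{imt}` as an element of `L_2(-π, π)`. -/
def expLp (m : ℤ) : H := (memLp_expChar m).toLp _

theorem expLp_ae (m : ℤ) : expLp m =ᵐ[nu] expChar m := MemLp.coeFn_toLp _

theorem inner_expLp (m : ℤ) (f : H) : inner ℂ (expLp m) f = ∫ t, expChar (-m) t * f t ∂nu := by
  rw [L2.inner_def]
  refine integral_congr_ae ((expLp_ae m).mono fun t ht => ?_)
  simp only [ht, RCLike.inner_apply', conj_expChar]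

theorem inner_expLp_expLp (m n : ℤ) :
    inner ℂ (expLp m) (expLp n) = if m = n then (2 * Real.pi : ℂ) else 0 := by
  have : inner ℂ (expLp m) (expLp n) = ∫ t, expChar (n - m) t ∂nu := by
    rw [inner_expLp]
    refine integral_congr_ae ((expLp_ae n).mono fun t ht => ?_)
    simp only [ht]
    rw [← expChar_add]
    congr 1
    ring
  rw [this, integral_expChar]
  simp only [sub_eq_zero, eq_comm]

theorem orthonormal_expLp :
    Orthonormal ℂ fun m : ℤ => ((Real.sqrt (2 * Real.pi))⁻¹ : ℂ) • expLp m := by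
  rw [orthonormal_iff_ite]
  intro m n
  rw [inner_smul_left, inner_smul_right, inner_expLp_expLp]
  split_ifs
  · have h : ((Real.sqrt (2 * Real.pi) : ℝ) : ℂ) * (Real.sqrt (2 * Real.pi) : ℝ) =
        2 * Real.pi := by
      rw [← Complex.ofReal_mul, Real.mul_self_sqrt (by positivity)]
      push_cast
      rfl
    have h0 : ((Real.sqrt (2 * Real.pi) : ℝ) : ℂ) ≠ 0 := by
      have : Real.sqrt (2 * Real.pi) ≠ 0 := by positivity
      exact_mod_cast this
    rw [← h, map_inv₀, Complex.conj_ofReal]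
    field_simp
  · simp

/-- Completeness of the characters, transferred from Parseval's identity for `fourierCoeffOn`. -/
theorem eq_zero_of_inner_expLp (f : H) (h : ∀ m, inner ℂ (expLp m) f = 0) : f = 0 := by
  have hab : -Real.pi < Real.pi := by linarith [Real.pi_pos]
  have hmem : MemLp f 2 (volume.restrict (Set.Ioc (-Real.pi) Real.pi)) := by
    rw [← Measure.restrict_congr_set (Ioo_ae_eq_Ioc (μ := volume))]
    exact Lp.memLp f
  have hcoeff : ∀ m, fourierCoeffOn hab f m = 0 := by
    intro m
    rw [fourierCoeffOn_eq_integral]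
    have h1 := h m
    rw [inner_expLp, integral_nu] at h1
    refine smul_eq_zero_of_right _ ?_
    rw [← h1]
    refine intervalIntegral.integral_congr fun t _ => ?_
    simp only [fourier_coe_apply, expChar, smul_eq_mul]
    congr 2
    have : (Real.pi : ℂ) ≠ 0 := by exact_mod_cast Real.pi_ne_zero
    push_cast
    field_simp
    ring
  have hsum := hasSum_sq_fourierCoeffOn hab hmem
  simp only [hcoeff, norm_zero, ne_eq, OfNat.ofNat_ne_zero, not_false_eq_true, zero_pow] at hsum
  have hzero := hsum.unique hasSum_zero
  have hnorm : ∫ t, ‖f t‖ ^ 2 ∂nu = 0 := by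
    have hne : (Real.pi - -Real.pi)⁻¹ ≠ 0 := by
      have := Real.pi_pos
      exact inv_ne_zero (by linarith)
    rw [smul_eq_zero_iff_right hne] at hzero
    rwa [← integral_Ioc_eq_integral_Ioo, ← intervalIntegral.integral_of_le hab.le]
  have hinner : inner ℂ f f = (0 : ℂ) := by
    rw [L2.inner_def]
    simp only [inner_self_eq_norm_sq_to_K]
    have := congrArg (fun x : ℝ => (x : ℂ)) hnorm
    simp only [← integral_complex_ofReal] at this
    simpa using this
  exact inner_self_eq_zero.1 hinner

/-- The Fourier basis of `L_2(-π, π)`. -/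
def fourierHilbertBasis : HilbertBasis ℤ ℂ H :=
  HilbertBasis.mkOfOrthogonalEqBot orthonormal_expLp <| by
    rw [Submodule.eq_bot_iff]
    intro f hf
    refine eq_zero_of_inner_expLp f fun m => ?_
    have h := (Submodule.mem_orthogonal _ f).1 hf _ (Submodule.subset_span ⟨m, rfl⟩)
    rw [inner_smul_left, mul_eq_zero] at h
    refine h.resolve_left ?_
    have : Real.sqrt (2 * Real.pi) ≠ 0 := by positivity
    simpa using this

theorem fourierHilbertBasis_apply (m : ℤ) :
    fourierHilbertBasis m = ((Real.sqrt (2 * Real.pi))⁻¹ : ℂ) • expLp m := by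
  rw [fourierHilbertBasis, HilbertBasis.coe_mkOfOrthogonalEqBot]

theorem apply_fourierHilbertBasis {T : H →L[ℂ] H} {α : ℂ} {m : ℤ}
    (h : T (expLp m) = α • expLp m) : T (fourierHilbertBasis m) = α • fourierHilbertBasis m := by
  rw [fourierHilbertBasis_apply, map_smul, h, smul_comm]

/-! ### Integral operators with bounded kernels and the operator of multiplication by `t` -/

theorem exists_isIntegralOperator {K : ℝ → ℝ → ℂ} (hK : Measurable (Function.uncurry K)) {C : ℝ}
    (hC : ∀ t s, ‖K t s‖ ≤ C) : ∃ T : H →L[ℂ] H, IsIntegralOperator K T := by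
  have hKt : ∀ t, Measurable (K t) := fun t => hK.comp measurable_prodMk_left
  have hmem : ∀ t, MemLp (fun s => conj (K t s)) 2 nu := fun t =>
    MemLp.of_bound (Complex.continuous_conj.measurable.comp (hKt t)).aestronglyMeasurable C
      (ae_of_all _ fun s => by simpa using hC t s)
  -- Conjugated rows of the kernel as vectors of `H`: the operator is `f ↦ (t ↦ ⟨k t, f⟩)`, bounded
  -- since the measure is finite.
  let k : ℝ → H := fun t => (hmem t).toLp _
  have hC0 : 0 ≤ C := (norm_nonneg _).trans (hC 0 0)
  set V : ℝ := (measureUnivNNReal nu : ℝ) ^ (2 : ℝ≥0∞).toReal⁻¹ with hV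
  have hV0 : 0 ≤ V := by positivity
  have hk : ∀ t, ‖k t‖ ≤ V * C := fun t => by
    refine Lp.norm_le_of_ae_bound hC0 ((hmem t).coeFn_toLp.mono fun s hs => ?_)
    simpa only [k, hs, RCLike.norm_conj] using hC t s
  have hform : ∀ f : H, ∀ t, inner ℂ (k t) f = ∫ s, K t s * f s ∂nu := fun f t => by
    rw [L2.inner_def]
    refine integral_congr_ae ((hmem t).coeFn_toLp.mono fun s hs => ?_)
    simp only [k, hs, RCLike.inner_apply', Complex.conj_conj]
  have hbound : ∀ (f : H) t, ‖inner ℂ (k t) f‖ ≤ V * C * ‖f‖ := fun f t =>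
    (norm_inner_le_norm _ _).trans (by gcongr; exact hk t)
  have hmeas : ∀ f : H, AEStronglyMeasurable (fun t => inner ℂ (k t) f) nu := fun f => by
    simp only [hform]
    refine AEStronglyMeasurable.integral_prod_right' (f := fun p : ℝ × ℝ => K p.1 p.2 * f p.2) ?_
    exact hK.aestronglyMeasurable.mul (Lp.aestronglyMeasurable f).comp_snd
  have hF : ∀ f : H, MemLp (fun t => inner ℂ (k t) f) 2 nu := fun f =>
    MemLp.of_bound (hmeas f) _ (ae_of_all _ (hbound f))
  let L : H →ₗ[ℂ] H :=
    { toFun := fun f => (hF f).toLp _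
      map_add' := fun f g => by
        rw [← MemLp.toLp_add]
        exact MemLp.toLp_congr _ _ (ae_of_all _ fun t => inner_add_right _ _ _)
      map_smul' := fun c f => by
        rw [RingHom.id_apply, ← MemLp.toLp_const_smul]
        exact MemLp.toLp_congr _ _ (ae_of_all _ fun t => inner_smul_right _ _ _) }
  refine ⟨L.mkContinuous (V * (V * C)) fun f => ?_, fun f => ?_⟩
  · rw [mul_assoc]
    refine Lp.norm_le_of_ae_bound (by positivity) ((hF f).coeFn_toLp.mono fun t ht => ?_)
    exact (congrArg norm ht).trans_le (hbound f t)
  · exact (hF f).coeFn_toLp.mono fun t ht => ht.trans (hform f t)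

theorem exists_mul_id : ∃ M : H →L[ℂ] H, ∀ f : H, ∀ᵐ t ∂nu, M f t = (t : ℂ) * f t := by
  have hmem : MemLp (fun t : ℝ => (t : ℂ)) ∞ nu := by
    refine memLp_top_of_bound Complex.continuous_ofReal.aestronglyMeasurable Real.pi ?_
    filter_upwards [ae_mem_Ioo] with t ht
    rw [Complex.norm_real, Real.norm_eq_abs]
    exact abs_le.2 ⟨ht.1.le, ht.2.le⟩
  refine ⟨(ContinuousLinearMap.mul ℂ ℂ).holderL nu ∞ 2 2 (hmem.toLp _), fun f => ?_⟩
  filter_upwards [(ContinuousLinearMap.mul ℂ ℂ).coeFn_holder (r := 2) (hmem.toLp _) f,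
    hmem.coeFn_toLp] with t h1 h2
  rw [ContinuousLinearMap.holderL_apply_apply, h1, h2]
  rfl

/-! ### The sawtooth kernel -/

theorem integral_affine_mul_expChar {l : ℤ} (hl : l ≠ 0) (c : ℂ) (a b : ℝ) :
    ∫ s in a..b, (c + s) * expChar l s =
      ((c + b) / (Complex.I * l) + 1 / (l : ℂ) ^ 2) * expChar l b -
        ((c + a) / (Complex.I * l) + 1 / (l : ℂ) ^ 2) * expChar l a := by
  have hl' : (l : ℂ) ≠ 0 := by exact_mod_cast hl
  refine intervalIntegral.integral_eq_sub_of_hasDerivAt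
    (f := fun s : ℝ => ((c + s) / (Complex.I * l) + 1 / (l : ℂ) ^ 2) * expChar l s) ?_ ?_
  · intro s _
    have h1 : HasDerivAt (fun s : ℝ => (c + s) / (Complex.I * l) + 1 / (l : ℂ) ^ 2)
        (1 / (Complex.I * l)) s :=
      (((Complex.ofRealCLM.hasDerivAt (x := s)).const_add c).div_const _).add_const _
    refine (h1.mul (hasDerivAt_expChar l s)).congr_deriv ?_
    field_simp
    ring_nf
    rw [Complex.I_sq]
    ring
  · refine Continuous.intervalIntegrable ?_ _ _
    have := continuous_expChar l
    fun_prop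

theorem integral_affine (c : ℂ) (a b : ℝ) :
    ∫ s in a..b, (c + s) = (c + b) ^ 2 / 2 - (c + a) ^ 2 / 2 := by
  refine intervalIntegral.integral_eq_sub_of_hasDerivAt
    (f := fun s : ℝ => (c + s) ^ 2 / 2) ?_ ?_
  · intro s _
    have h1 : HasDerivAt (fun s : ℝ => c + s) 1 s :=
      (Complex.ofRealCLM.hasDerivAt (x := s)).const_add c
    refine ((h1.pow 2).div_const 2).congr_deriv ?_
    simp
  · refine Continuous.intervalIntegrable ?_ _ _
    fun_prop

/-- For `l = 0` both sides vanish. -/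
theorem integral_sawtooth_mul_expChar {t : ℝ} (ht : t ∈ Set.Ioo (-Real.pi) Real.pi) (l : ℤ) :
    ∫ s, ((Real.pi * Real.sign (t - s) - (t - s) : ℝ) : ℂ) * expChar l s ∂nu =
      2 * Real.pi / (Complex.I * l) * expChar l t := by
  have hE := continuous_expChar l
  have hleft : Set.EqOn (fun s => ((Real.pi * Real.sign (t - s) - (t - s) : ℝ) : ℂ) * expChar l s)
      (fun s => (((Real.pi - t : ℝ) : ℂ) + s) * expChar l s) (Set.uIoo (-Real.pi) t) := by
    intro s hs
    rw [Set.uIoo_of_lt ht.1] at hs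
    simp only [Real.sign_of_pos (sub_pos.2 hs.2)]
    push_cast
    ring
  have hright : Set.EqOn (fun s => ((Real.pi * Real.sign (t - s) - (t - s) : ℝ) : ℂ) * expChar l s)
      (fun s => (((-Real.pi - t : ℝ) : ℂ) + s) * expChar l s) (Set.uIoo t Real.pi) := by
    intro s hs
    rw [Set.uIoo_of_lt ht.2] at hs
    simp only [Real.sign_of_neg (sub_neg.2 hs.1)]
    push_cast
    ring
  have hc : ∀ c a b, IntervalIntegrable (fun s : ℝ => ((c : ℂ) + s) * expChar l s) volume a b :=
    fun c a b => Continuous.intervalIntegrable (by fun_prop) _ _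
  rw [integral_nu, ← intervalIntegral.integral_add_adjacent_intervals (b := t)
    ((hc _ _ _).congr_uIoo hleft.symm) ((hc _ _ _).congr_uIoo hright.symm),
    intervalIntegral.integral_congr_uIoo hleft, intervalIntegral.integral_congr_uIoo hright]
  by_cases hl : l = 0
  · subst hl
    simp only [expChar_zero, mul_one, integral_affine]
    push_cast
    simp
    ring
  -- The contributions at `-π` and `π` cancel by periodicity, both affine factors being `-t` there;
  -- the jump `2π` of the sawtooth at `s = t` remains.
  · rw [integral_affine_mul_expChar hl, integral_affine_mul_expChar hl, expChar_neg_pi]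
    have hl' : (l : ℂ) ≠ 0 := by exact_mod_cast hl
    push_cast
    field_simp
    ring

/-! ### The discrete Hilbert transform of a decreasing sequence -/

section Sequence

variable {y : ℕ → ℝ}

theorem sum_comp_le_tsum {φ : ℕ → ℝ} (hφ : Summable φ) (h0 : ∀ n, 0 ≤ φ n) {s : Finset ℕ}
    {g : ℕ → ℕ} (hg : Set.InjOn g s) : ∑ k ∈ s, φ (g k) ≤ ∑' n, φ n := by
  rw [← Finset.sum_image hg]
  exact hφ.sum_le_tsum _ fun n _ => h0 n

/-- The Hilbert transform of a decreasing sequence is bounded uniformly in `m`. Each term is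
dominated by terms `y n / (n + 1)`, and three injective reindexings cover all cases; the term `k =
m` is `0` by the convention for division. -/
theorem sum_div_abs_le (hy : Antitone y) (h0 : ∀ n, 0 ≤ y n)
    (hs : Summable fun n : ℕ => y n / ((n : ℝ) + 1)) (m : ℤ) (J : ℕ) :
    ∑ k ∈ Finset.range J, y k / |(m : ℝ) - k| ≤ 3 * ∑' n : ℕ, y n / ((n : ℝ) + 1) := by
  set φ : ℕ → ℝ := fun n => y n / ((n : ℝ) + 1) with hφ
  have hφ0 : ∀ n, 0 ≤ φ n := fun n => div_nonneg (h0 n) (by positivity)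
  have htot : 0 ≤ ∑' n, φ n := tsum_nonneg hφ0
  have hid : ∑ k ∈ Finset.range J, φ k ≤ ∑' n, φ n := hs.sum_le_tsum _ fun n _ => hφ0 n
  rcases lt_or_ge m 0 with hm | hm
  · refine le_trans (Finset.sum_le_sum fun k _ => ?_) (hid.trans (by linarith))
    have h1 : (m : ℝ) ≤ -1 := by exact_mod_cast Int.le_sub_one_of_lt hm
    have h2 : (k : ℝ) + 1 ≤ |(m : ℝ) - k| := by
      rw [abs_sub_comm]
      exact le_trans (by linarith) (le_abs_self _)
    exact div_le_div_of_nonneg_left (h0 k) (by positivity) h2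
  · lift m to ℕ using hm
    have hterm : ∀ k : ℕ, y k / |((m : ℤ) : ℝ) - k| ≤ φ k +
        (if k < m then φ (m - 1 - k) else 0) + (if m < k then φ (k - m - 1) else 0) := by
      intro k
      rcases lt_trichotomy k m with h | rfl | h
      · obtain ⟨d, rfl⟩ := Nat.exists_eq_add_of_lt h
        have e1 : k + d + 1 - 1 - k = d := by omega
        have e2 : |(((k + d + 1 : ℕ) : ℤ) : ℝ) - k| = d + 1 := by
          push_cast
          rw [show (k : ℝ) + d + 1 - k = d + 1 by ring]
          exact abs_of_pos (by positivity)
        rw [if_pos h, if_neg (by omega), e1, e2, add_zero]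
        -- Here `d + 1 = m - k`. If `k ≤ d`, enlarge `1 / (d + 1)` to `1 / (k + 1)`; otherwise
        -- enlarge `y k` to `y d`.
        rcases le_total k d with hkd | hkd
        · refine le_trans ?_ (le_add_of_nonneg_right (hφ0 d))
          exact div_le_div_of_nonneg_left (h0 k) (by positivity) (by gcongr)
        · refine le_trans ?_ (le_add_of_nonneg_left (hφ0 k))
          exact div_le_div_of_nonneg_right (hy hkd) (by positivity)
      · simpa using hφ0 k
      · obtain ⟨d, rfl⟩ := Nat.exists_eq_add_of_lt h
        have e1 : m + d + 1 - m - 1 = d := by omega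
        have e2 : |((m : ℤ) : ℝ) - (m + d + 1 : ℕ)| = d + 1 := by
          push_cast
          rw [abs_sub_comm, show (m : ℝ) + d + 1 - m = d + 1 by ring]
          exact abs_of_pos (by positivity)
        rw [if_pos h, if_neg (by omega), e1, e2, add_zero]
        refine le_trans ?_ (le_add_of_nonneg_left (hφ0 _))
        exact div_le_div_of_nonneg_right (hy (by omega)) (by positivity)
    refine (Finset.sum_le_sum fun k _ => hterm k).trans ?_
    rw [Finset.sum_add_distrib, Finset.sum_add_distrib, ← Finset.sum_filter, ← Finset.sum_filter]
    have hleft : ∑ k ∈ Finset.range J with k < m, φ (m - 1 - k) ≤ ∑' n, φ n :=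
      sum_comp_le_tsum (g := fun k => m - 1 - k) hs hφ0 fun k hk l hl h => by
        simp only [Finset.coe_filter, Set.mem_ofPred_eq] at hk hl h
        have := hk.2
        have := hl.2
        omega
    have hright : ∑ k ∈ Finset.range J with m < k, φ (k - m - 1) ≤ ∑' n, φ n :=
      sum_comp_le_tsum (g := fun k => k - m - 1) hs hφ0 fun k hk l hl h => by
        simp only [Finset.coe_filter, Set.mem_ofPred_eq] at hk hl h
        have := hk.2
        have := hl.2
        omega
    linarith

/-- The norm in `Λ_log` of the shifted sequence `y (· + j)`. -/
def tailNorm (y : ℕ → ℝ) (j : ℕ) : ℝ := ∑' i : ℕ, y (i + j) / ((i : ℝ) + 1)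

theorem summable_shift_div (hy : Antitone y) (h0 : ∀ n, 0 ≤ y n)
    (hs : Summable fun n : ℕ => y n / ((n : ℝ) + 1)) (j : ℕ) :
    Summable fun i : ℕ => y (i + j) / ((i : ℝ) + 1) :=
  hs.of_nonneg_of_le (fun i => div_nonneg (h0 _) (by positivity)) fun i =>
    div_le_div_of_nonneg_right (hy (by omega)) (by positivity)

/-- A positive limit would make the harmonic series converge. -/
theorem tendsto_zero_of_summable_div (hy : Antitone y) (h0 : ∀ n, 0 ≤ y n)
    (hs : Summable fun n : ℕ => y n / ((n : ℝ) + 1)) : Tendsto y atTop (𝓝 0) := by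
  have hbdd : BddBelow (Set.range y) := ⟨0, by rintro _ ⟨n, rfl⟩; exact h0 n⟩
  have hlim := tendsto_atTop_ciInf hy hbdd
  set L := ⨅ i, y i
  have hL0 : 0 ≤ L := le_ciInf h0
  rcases hL0.eq_or_lt with hL | hL
  · rwa [← hL] at hlim
  · exfalso
    have h1 : Summable fun n : ℕ => L * (1 / ((n : ℝ) + 1)) :=
      hs.of_nonneg_of_le (fun n => by positivity) fun n => by
        rw [mul_one_div]
        exact div_le_div_of_nonneg_right (ciInf_le hbdd n) (by positivity)
    have h2 := (summable_mul_left_iff hL.ne').1 h1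
    have h3 := (summable_nat_add_iff (f := fun n : ℕ => 1 / (n : ℝ)) 1).1 (by simpa using h2)
    exact Real.not_summable_one_div_natCast h3

theorem tendsto_tailNorm (hy : Antitone y) (h0 : ∀ n, 0 ≤ y n)
    (hs : Summable fun n : ℕ => y n / ((n : ℝ) + 1)) : Tendsto (tailNorm y) atTop (𝓝 0) := by
  have h := tendsto_tsum_of_dominated_convergence (𝓕 := atTop)
    (f := fun (j : ℕ) (i : ℕ) => y (i + j) / ((i : ℝ) + 1)) (g := fun _ => (0 : ℝ)) hs ?_ ?_
  · rw [tsum_zero] at h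
    exact h
  · intro i
    have h1 : Tendsto (fun j => y (i + j)) atTop (𝓝 0) :=
      (tendsto_zero_of_summable_div hy h0 hs).comp (tendsto_add_atTop_nat i |>.congr fun j =>
        add_comm j i)
    simpa using h1.div_const ((i : ℝ) + 1)
  · refine Eventually.of_forall fun j i => ?_
    rw [Real.norm_of_nonneg (div_nonneg (h0 _) (by positivity))]
    exact div_le_div_of_nonneg_right (hy (by omega)) (by positivity)

theorem summable_hilbert (hy : Antitone y) (h0 : ∀ n, 0 ≤ y n)
    (hs : Summable fun n : ℕ => y n / ((n : ℝ) + 1)) (m : ℤ) :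
    Summable fun k : ℕ => y k / ((m : ℝ) - k) := by
  refine Summable.of_norm (summable_of_sum_range_le (c := 3 * ∑' n : ℕ, y n / ((n : ℝ) + 1))
    (fun _ => norm_nonneg _) fun J => ?_)
  refine le_trans (Finset.sum_le_sum fun k _ => le_of_eq ?_) (sum_div_abs_le hy h0 hs m J)
  rw [norm_div, Real.norm_of_nonneg (h0 k), Real.norm_eq_abs]

/-- The discrete Hilbert transform of a sequence on `ℤ₊`, extended by zero to `ℤ`; the term
with `k = m` vanishes. -/
def hilbert (y : ℕ → ℝ) (m : ℤ) : ℝ := ∑' k : ℕ, y k / ((m : ℝ) - k)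

/-- The remainder is the Hilbert transform of the shifted sequence at `m - j`, so the uniform bound
applies to it. -/
theorem abs_sum_sub_hilbert_le (hy : Antitone y) (h0 : ∀ n, 0 ≤ y n)
    (hs : Summable fun n : ℕ => y n / ((n : ℝ) + 1)) (m : ℤ) (j : ℕ) :
    |∑ k ∈ Finset.range j, y k / ((m : ℝ) - k) - hilbert y m| ≤ 3 * tailNorm y j := by
  have h := (summable_hilbert hy h0 hs m).sum_add_tsum_nat_add j
  rw [hilbert, ← h, sub_add_cancel_left, abs_neg]
  have hsum := (summable_nat_add_iff j).2 (summable_hilbert hy h0 hs m)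
  refine le_trans (norm_tsum_le_tsum_norm hsum.norm) (hsum.norm.tsum_le_of_sum_range_le fun J => ?_)
  refine le_trans (Finset.sum_le_sum fun k _ => le_of_eq ?_)
    (sum_div_abs_le (y := fun i => y (i + j)) (fun a b hab => hy (by omega)) (fun _ => h0 _)
      (summable_shift_div hy h0 hs j) (m - j) J)
  rw [norm_div, Real.norm_of_nonneg (h0 _), Real.norm_eq_abs]
  push_cast
  ring_nf

theorem abs_hilbert_le (hy : Antitone y) (h0 : ∀ n, 0 ≤ y n)
    (hs : Summable fun n : ℕ => y n / ((n : ℝ) + 1)) (m : ℤ) :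
    |hilbert y m| ≤ 3 * tailNorm y 0 := by
  simpa using abs_sum_sub_hilbert_le hy h0 hs m 0

/-- For negative `m` no cancellation occurs. As `-m ≤ n + 1`, the denominator `k - m` is at most `2
(n + 1)` when `k ≤ n` and at most `2 (k + 1)` when `k ≥ n`, which bounds the two halves of
`calderon` separately. -/
theorem calderon_le_abs_hilbert (hy : Antitone y) (h0 : ∀ n, 0 ≤ y n)
    (hs : Summable fun n : ℕ => y n / ((n : ℝ) + 1)) {n : ℕ} {m : ℤ} (hm : m < 0)
    (hmn : -(n + 1 : ℤ) ≤ m) : calderon y n ≤ 4 * |hilbert y m| := by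
  have hm1 : (m : ℝ) ≤ -1 := by exact_mod_cast Int.le_sub_one_of_lt hm
  have hmn1 : -((n : ℝ) + 1) ≤ m := by exact_mod_cast hmn
  set G : ℕ → ℝ := fun k => y k / ((k : ℝ) - m) with hG
  have hpos : ∀ k : ℕ, 0 < (k : ℝ) - m := fun k => by
    have : (0 : ℝ) ≤ k := k.cast_nonneg
    linarith
  have hG0 : ∀ k, 0 ≤ G k := fun k => div_nonneg (h0 k) (hpos k).le
  have hGneg : ∀ k : ℕ, y k / ((m : ℝ) - k) = -G k := fun k => by
    rw [hG, ← div_neg, neg_sub]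
  have hGs : Summable G := by
    simpa [hGneg] using (summable_hilbert hy h0 hs m).neg
  have habs : |hilbert y m| = ∑' k, G k := by
    simp only [hilbert, hGneg, tsum_neg, abs_neg]
    exact abs_of_nonneg (tsum_nonneg hG0)
  have h1 : cesaro y n ≤ 2 * ∑' k, G k := by
    refine le_trans ?_ (mul_le_mul_of_nonneg_left (hGs.sum_le_tsum (Finset.range (n + 1))
      fun k _ => hG0 k) zero_le_two)
    rw [cesaro, Finset.mul_sum, Finset.mul_sum]
    refine Finset.sum_le_sum fun k hk => ?_
    have hk' : (k : ℝ) ≤ n := by exact_mod_cast Nat.lt_succ_iff.1 (Finset.mem_range.1 hk)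
    rw [hG, one_div_mul_eq_div, mul_div_assoc', div_le_div_iff₀ (by positivity) (hpos k)]
    nlinarith [h0 k]
  have h2 : cesaroAdj y n ≤ 2 * ∑' k, G k := by
    have hGt : Summable fun j => 2 * G (n + j) := by
      have := ((summable_nat_add_iff n).2 hGs).mul_left 2
      simpa only [add_comm] using this
    have hle : ∀ j : ℕ, y (n + j) / (((n + j : ℕ) : ℝ) + 1) ≤ 2 * G (n + j) := fun j => by
      have hj : (0 : ℝ) ≤ j := j.cast_nonneg
      rw [hG, mul_div_assoc', div_le_div_iff₀ (by positivity) (hpos _)]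
      push_cast
      nlinarith [h0 (n + j)]
    have hadj := Summable.tsum_le_tsum hle
      (hGt.of_nonneg_of_le (fun j => div_nonneg (h0 _) (by positivity)) hle) hGt
    refine hadj.trans ?_
    rw [tsum_mul_left]
    have := hGs.sum_add_tsum_nat_add n
    have h3 : 0 ≤ ∑ k ∈ Finset.range n, G k := Finset.sum_nonneg fun k _ => hG0 k
    have h4 : ∑' j, G (n + j) = ∑' j, G (j + n) := by simp only [add_comm]
    linarith
  rw [calderon, habs]
  linarith

end Sequence

/-! ### Convolution operators with trigonometric polynomials -/

/-- The convolution kernel whose eigenvalues are `y k`, `0 ≤ k < j`. -/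
def convKernel (y : ℕ → ℝ) (j : ℕ) (t s : ℝ) : ℂ :=
  ∑ k ∈ Finset.range j, ((y k : ℂ) / (2 * Real.pi)) * expChar k (t - s)

/-- The extension of `y` by zero to `ℤ`. -/
def extend (y : ℕ → ℝ) (m : ℤ) : ℂ := if 0 ≤ m then (y m.toNat : ℂ) else 0

theorem continuous_convKernel (y : ℕ → ℝ) (j : ℕ) :
    Continuous (Function.uncurry (convKernel y j)) := by
  unfold convKernel Function.uncurry
  have h := fun k : ℕ => continuous_expChar k
  fun_prop

theorem norm_convKernel_le (y : ℕ → ℝ) (j : ℕ) (t s : ℝ) :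
    ‖convKernel y j t s‖ ≤ ∑ k ∈ Finset.range j, ‖(y k : ℂ) / (2 * Real.pi)‖ := by
  refine (norm_sum_le _ _).trans (Finset.sum_le_sum fun k _ => ?_)
  rw [norm_mul, norm_expChar, mul_one]

theorem memLp_convKernel (y : ℕ → ℝ) (j : ℕ) :
    MemLp (Function.uncurry (convKernel y j)) 2 (nu.prod nu) :=
  MemLp.of_bound (continuous_convKernel y j).aestronglyMeasurable _
    (ae_of_all _ fun p => norm_convKernel_le y j p.1 p.2)

theorem measurable_truncKernel {K : ℝ → ℝ → ℂ} (hK : Measurable (Function.uncurry K)) :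
    Measurable (Function.uncurry (truncKernel K)) :=
  (Complex.measurable_ofReal.comp
    (measurable_sign.comp (measurable_fst.sub measurable_snd))).mul hK

theorem norm_truncKernel_le (K : ℝ → ℝ → ℂ) (t s : ℝ) : ‖truncKernel K t s‖ ≤ ‖K t s‖ := by
  rw [truncKernel, norm_mul]
  exact mul_le_of_le_one_left (norm_nonneg _) (norm_sign_le _)

/-- The weight `p` is `1` for the eigenvalues of the convolution operator itself, and the sawtooth
for those of `R`. -/
theorem integral_mul_convKernel (y : ℕ → ℝ) (j : ℕ) (m : ℤ) (t : ℝ) {p : ℝ → ℂ}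
    (hp : Measurable p) {C : ℝ} (hC : ∀ s ∈ Set.Ioo (-Real.pi) Real.pi, ‖p s‖ ≤ C) :
    ∫ s, p s * (convKernel y j t s * expChar m s) ∂nu =
      ∑ k ∈ Finset.range j, ((y k : ℂ) / (2 * Real.pi)) * expChar k t *
        ∫ s, p s * expChar (m - k) s ∂nu := by
  have hint : ∀ l, Integrable (fun s => p s * expChar l s) nu := fun l => by
    refine Integrable.of_bound (C := C)
      (hp.mul (continuous_expChar l).measurable).aestronglyMeasurable ?_
    filter_upwards [ae_mem_Ioo] with s hs
    rw [norm_mul, norm_expChar, mul_one]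
    exact hC s hs
  have hsum : ∀ s, p s * (convKernel y j t s * expChar m s) = ∑ k ∈ Finset.range j,
      ((y k : ℂ) / (2 * Real.pi)) * expChar k t * (p s * expChar (m - k) s) := fun s => by
    rw [convKernel, Finset.sum_mul, Finset.mul_sum]
    refine Finset.sum_congr rfl fun k _ => ?_
    rw [expChar_sub_right, sub_eq_add_neg, expChar_add m]
    ring
  simp only [hsum]
  rw [integral_finsetSum _ fun k _ => (hint _).const_mul _]
  simp only [integral_const_mul]

theorem IsIntegralOperator.apply_expLp {K : ℝ → ℝ → ℂ} {A : H →L[ℂ] H}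
    (hA : IsIntegralOperator K A) (m : ℤ) :
    ∀ᵐ t ∂nu, A (expLp m) t = ∫ s, K t s * expChar m s ∂nu := by
  filter_upwards [hA (expLp m)] with t ht
  rw [ht]
  exact integral_congr_ae ((expLp_ae m).mono fun s hs => by simp only [hs])

theorem norm_extend_le {y : ℕ → ℝ} (hy : Antitone y) (h0 : ∀ n, 0 ≤ y n) {m : ℤ} {n : ℕ}
    (hn : n ≤ m.toNat) : ‖extend y m‖ ≤ y n := by
  rw [extend]
  split_ifs
  · rw [Complex.norm_real, Real.norm_of_nonneg (h0 _)]
    exact hy hn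
  · simpa using h0 n

theorem isDiag_convKernel {y : ℕ → ℝ} (hy : Antitone y) (h0 : ∀ n, 0 ≤ y n) {j : ℕ}
    {A : H →L[ℂ] H} (hA : IsIntegralOperator (convKernel y j) A) :
    IsDiag fourierHilbertBasis (fun m => if m < j then extend y m else 0) A := by
  refine isDiag_of_apply_basis _ (C := y 0) (fun m => ?_) fun m => apply_fourierHilbertBasis ?_
  · split_ifs
    · exact norm_extend_le hy h0 (Nat.zero_le _)
    · simpa using h0 0
  · refine Lp.ext ?_
    filter_upwards [hA.apply_expLp m, expLp_ae m,
      Lp.coeFn_smul (if m < j then extend y m else 0) (expLp m)] with t h1 h2 h3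
    rw [h1, h3, Pi.smul_apply, h2, smul_eq_mul]
    have h4 := integral_mul_convKernel y j m t (p := fun _ => 1) measurable_const (C := 1)
      (by simp)
    simp only [one_mul, integral_expChar] at h4
    rw [h4]
    have hpi : (2 * Real.pi : ℂ) ≠ 0 := by
      simp
    by_cases hm : 0 ≤ m ∧ m < j
    · obtain ⟨hm0, hmj⟩ := hm
      lift m to ℕ using hm0
      have hmj' : m < j := by exact_mod_cast hmj
      rw [Finset.sum_eq_single_of_mem m (Finset.mem_range.2 hmj')]
      · rw [if_pos (sub_self _), if_pos hmj, extend, if_pos (Int.natCast_nonneg _), Int.toNat_natCast]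
        field_simp
      · intro k _ hk
        rw [if_neg (by omega), mul_zero]
    · rw [Finset.sum_eq_zero fun k hk => ?_]
      · split_ifs with h
        · rw [extend, if_neg fun h' => hm ⟨h', h⟩, zero_mul]
        · rw [zero_mul]
      · have := Finset.mem_range.1 hk
        rw [if_neg (by omega), mul_zero]

theorem sawtooth_convKernel_mul_expChar (y : ℕ → ℝ) (j : ℕ) (m : ℤ) {t : ℝ}
    (ht : t ∈ Set.Ioo (-Real.pi) Real.pi) :
    ∫ s, ((Real.pi * Real.sign (t - s) - (t - s) : ℝ) : ℂ) *
        (convKernel y j t s * expChar m s) ∂nu =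
      -Complex.I * (∑ k ∈ Finset.range j, y k / ((m : ℝ) - k) : ℝ) * expChar m t := by
  -- `3π` comes from `|π sgn(t - s)| ≤ π` and `|t - s| < 2π`.
  rw [integral_mul_convKernel y j m t (C := 3 * Real.pi)]
  · push_cast
    rw [Finset.mul_sum, Finset.sum_mul]
    refine Finset.sum_congr rfl fun k _ => ?_
    have hl := integral_sawtooth_mul_expChar ht (m - k)
    push_cast at hl
    rw [hl, show expChar m t = expChar k t * expChar (m - k) t by rw [← expChar_add]; ring_nf]
    have hpi : (Real.pi : ℂ) ≠ 0 := by exact_mod_cast Real.pi_ne_zero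
    -- At `k = m` the sawtooth has mean zero, in agreement with division by zero giving `0`.
    by_cases hmk : (m : ℂ) - k = 0
    · simp [hmk]
    · field_simp
      rw [Complex.I_sq]
      ring
  · exact Complex.measurable_ofReal.comp (((measurable_const.mul
      (measurable_sign.comp (measurable_const.sub measurable_id)))).sub
        (measurable_const.sub measurable_id))
  · intro s hs'
    rw [Complex.norm_real, Real.norm_eq_abs]
    have hpi := Real.pi_pos
    have h1 := ht.1
    have h2 := ht.2
    have h3 := hs'.1
    have h4 := hs'.2
    rcases Real.sign_apply_eq (t - s) with h | h | h <;> rw [h] <;>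
      exact abs_le.2 ⟨by linarith, by linarith⟩

theorem integral_truncKernel_sub_commutator (y : ℕ → ℝ) (j : ℕ) (m : ℤ) {t : ℝ}
    (ht : t ∈ Set.Ioo (-Real.pi) Real.pi) :
    (Real.pi : ℂ) * ∫ s, truncKernel (convKernel y j) t s * expChar m s ∂nu -
      ((t : ℂ) * ∫ s, convKernel y j t s * expChar m s ∂nu -
        ∫ s, (s : ℂ) * (convKernel y j t s * expChar m s) ∂nu) =
      -Complex.I * (∑ k ∈ Finset.range j, y k / ((m : ℝ) - k) : ℝ) * expChar m t := by
  obtain ⟨D, hK⟩ : ∃ D : ℝ, ∀ t s, ‖convKernel y j t s‖ ≤ D :=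
    ⟨_, norm_convKernel_le y j⟩
  have hKm : Measurable (convKernel y j t) :=
    (continuous_convKernel y j).measurable.of_uncurry_left
  have hTm : Measurable (truncKernel (convKernel y j) t) :=
    (measurable_truncKernel (continuous_convKernel y j).measurable).of_uncurry_left
  have hEm := (continuous_expChar m).measurable
  have hint1 : Integrable (fun s => truncKernel (convKernel y j) t s * expChar m s) nu := by
    refine Integrable.of_bound (C := D) (hTm.mul hEm).aestronglyMeasurable
      (ae_of_all _ fun s => ?_)
    rw [norm_mul, norm_expChar, mul_one]
    exact (norm_truncKernel_le _ _ _).trans (hK t s)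
  have hint2 : Integrable (fun s => convKernel y j t s * expChar m s) nu := by
    refine Integrable.of_bound (C := D) (hKm.mul hEm).aestronglyMeasurable
      (ae_of_all _ fun s => ?_)
    rw [norm_mul, norm_expChar, mul_one]
    exact hK t s
  have hint3 : Integrable (fun s : ℝ => (s : ℂ) * (convKernel y j t s * expChar m s)) nu := by
    refine hint2.bdd_mul (c := Real.pi) Complex.continuous_ofReal.aestronglyMeasurable ?_
    filter_upwards [ae_mem_Ioo] with s hs
    rw [Complex.norm_real, Real.norm_eq_abs]
    exact abs_le.2 ⟨hs.1.le, hs.2.le⟩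
  rw [← sawtooth_convKernel_mul_expChar y j m ht]
  generalize convKernel y j = K at *
  have e1 := integral_sub (hint2.const_mul (t : ℂ)) hint3
  have e2 := integral_sub (hint1.const_mul (Real.pi : ℂ)) ((hint2.const_mul (t : ℂ)).sub hint3)
  simp only [Pi.sub_apply] at e2
  rw [← integral_const_mul, ← integral_const_mul, ← e1, ← e2]
  refine integral_congr_ae (ae_of_all _ fun s => ?_)
  simp only [truncKernel]
  push_cast
  ring

/-- The truncation of a convolution operator, up to a commutator with the multiplication by `t`,
is again a convolution operator. -/
theorem isDiag_truncKernel_sub_commutator {y : ℕ → ℝ} (hy : Antitone y) (h0 : ∀ n, 0 ≤ y n)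
    (hs : Summable fun n : ℕ => y n / ((n : ℝ) + 1)) {j : ℕ} {A B M : H →L[ℂ] H}
    (hA : IsIntegralOperator (convKernel y j) A)
    (hB : IsIntegralOperator (truncKernel (convKernel y j)) B)
    (hM : ∀ f : H, ∀ᵐ t ∂nu, M f t = (t : ℂ) * f t) :
    IsDiag fourierHilbertBasis
      (fun m => -Complex.I * (∑ k ∈ Finset.range j, y k / ((m : ℝ) - k) : ℝ))
      ((Real.pi : ℂ) • B - (M * A - A * M)) := by
  refine isDiag_of_apply_basis _ (C := 3 * tailNorm y j + 3 * tailNorm y 0) (fun m => ?_)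
    fun m => apply_fourierHilbertBasis ?_
  · rw [norm_mul, norm_neg, Complex.norm_I, one_mul, Complex.norm_real, Real.norm_eq_abs]
    have h1 := abs_sum_sub_hilbert_le hy h0 hs m j
    have h2 := abs_hilbert_le hy h0 hs m
    have h3 := abs_sub_abs_le_abs_sub (∑ k ∈ Finset.range j, y k / ((m : ℝ) - k)) (hilbert y m)
    linarith
  set c : ℂ := -Complex.I * (∑ k ∈ Finset.range j, y k / ((m : ℝ) - k) : ℝ) with hc
  have hsplit : ((Real.pi : ℂ) • B - (M * A - A * M)) (expLp m) =
      (Real.pi : ℂ) • B (expLp m) - (M (A (expLp m)) - A (M (expLp m))) := rfl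
  rw [hsplit]
  refine Lp.ext ?_
  filter_upwards [Lp.coeFn_sub ((Real.pi : ℂ) • B (expLp m)) (M (A (expLp m)) - A (M (expLp m))),
    Lp.coeFn_sub (M (A (expLp m))) (A (M (expLp m))), Lp.coeFn_smul (Real.pi : ℂ) (B (expLp m)),
    hM (A (expLp m)), hA (M (expLp m)), hA.apply_expLp m, hB.apply_expLp m,
    Lp.coeFn_smul c (expLp m), expLp_ae m, ae_mem_Ioo] with t h1 h2 h3 h4 h5 h6 h7 h8 h9 ht
  rw [h1, Pi.sub_apply, h2, Pi.sub_apply, h3, Pi.smul_apply, h4, h5, h6, h7, h8, Pi.smul_apply, h9,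
    smul_eq_mul, smul_eq_mul]
  have hMint : ∫ s, convKernel y j t s * M (expLp m) s ∂nu =
      ∫ s, (s : ℂ) * (convKernel y j t s * expChar m s) ∂nu := by
    refine integral_congr_ae ?_
    filter_upwards [hM (expLp m), expLp_ae m] with s hs1 hs2
    rw [hs1, hs2]
    ring
  rw [hMint, hc]
  exact integral_truncKernel_sub_commutator y j m ht

/-! ### The operator `a`, its truncation, and the lower bound for the singular values. -/

section Construction

variable {y : ℕ → ℝ}

/-- As `y` decreases, deleting the frequencies `0, …, n - 1` gives the upper bound, and compressing
to `0, …, n` the lower one. -/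
theorem opMu_eq_of_isDiag_extend (hy : Antitone y) (h0 : ∀ n, 0 ≤ y n) {a : H →L[ℂ] H}
    (ha : IsDiag fourierHilbertBasis (extend y) a) (n : ℕ) : opMu a n = y n := by
  refine le_antisymm ?_ ?_
  · refine ha.opMu_le (Finset.Ico (0 : ℤ) n) (by simp) (h0 n) fun m hm => ?_
    rw [Finset.mem_Ico, not_and_or] at hm
    rcases hm with hm | hm
    · rw [extend, if_neg hm, norm_zero]
      exact h0 n
    · exact norm_extend_le hy h0 (by omega)
  · refine le_opMu_of_compression (b := fourierHilbertBasis) (α := extend y)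
      (Finset.Ico (0 : ℤ) (n + 1)) (by simp) (fun m hm => ?_) fun i _ j _ => ?_
    · rw [Finset.mem_Ico] at hm
      rw [extend, if_pos hm.1, Complex.norm_real, Real.norm_of_nonneg (h0 _)]
      exact hy (by omega)
    · rw [ha.apply_basis, map_smul]
      rfl

/-- The difference has eigenvalues `-y m` at `m ≥ j` only, so its `n`-th singular value is at most
`y (n + j)`. -/
theorem lambdaLogNorm_sub_le (hy : Antitone y) (h0 : ∀ n, 0 ≤ y n)
    (hs : Summable fun n : ℕ => y n / ((n : ℝ) + 1)) {j : ℕ} {A a : H →L[ℂ] H}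
    (hA : IsDiag fourierHilbertBasis (fun m => if m < j then extend y m else 0) A)
    (ha : IsDiag fourierHilbertBasis (extend y) a) :
    lambdaLogNorm (A - a) ≤ ENNReal.ofReal (tailNorm y j) := by
  rw [tailNorm, ENNReal.ofReal_tsum_of_nonneg (fun i => div_nonneg (h0 _) (by positivity))
    (summable_shift_div hy h0 hs j)]
  refine ENNReal.tsum_le_tsum fun n => ENNReal.ofReal_le_ofReal ?_
  refine div_le_div_of_nonneg_right ?_ (by positivity)
  refine (hA.sub ha).opMu_le (Finset.Ico (j : ℤ) (j + n)) (by simp) (h0 _) fun m hm => ?_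
  rw [Finset.mem_Ico, not_and_or] at hm
  by_cases hmj : m < j
  · rw [if_pos hmj, sub_self, norm_zero]
    exact h0 _
  · rw [if_neg hmj, zero_sub, norm_neg]
    exact norm_extend_le hy h0 (by omega)

theorem tendsto_lambdaLogNorm_sub (hy : Antitone y) (h0 : ∀ n, 0 ≤ y n)
    (hs : Summable fun n : ℕ => y n / ((n : ℝ) + 1)) {A : ℕ → H →L[ℂ] H} {a : H →L[ℂ] H}
    (hA : ∀ j : ℕ, IsDiag fourierHilbertBasis (fun m => if m < j then extend y m else 0) (A j))
    (ha : IsDiag fourierHilbertBasis (extend y) a) :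
    Tendsto (fun j => lambdaLogNorm (A j - a)) atTop (𝓝 0) := by
  have h := ENNReal.tendsto_ofReal (tendsto_tailNorm hy h0 hs)
  rw [ENNReal.ofReal_zero] at h
  exact tendsto_of_tendsto_of_tendsto_of_le_of_le tendsto_const_nhds h (fun _ => zero_le)
    fun j => lambdaLogNorm_sub_le hy h0 hs (hA j) ha

/-- The operator `π⁻¹ ([M, a] + R)`, which is the truncation of a convolution operator `a` when `M` is
the multiplication by `t` and `R` is a suitable convolution operator. -/
def truncOp (a R M : H →L[ℂ] H) : H →L[ℂ] H := (Real.pi : ℂ)⁻¹ • (M * a - a * M + R)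

theorem isTriangularTruncation_truncOp (hy : Antitone y) (h0 : ∀ n, 0 ≤ y n)
    (hs : Summable fun n : ℕ => y n / ((n : ℝ) + 1)) {a R M : H →L[ℂ] H}
    (ha : IsDiag fourierHilbertBasis (extend y) a)
    (hR : IsDiag fourierHilbertBasis (fun m => -Complex.I * (hilbert y m : ℝ)) R)
    (hM : ∀ f : H, ∀ᵐ t ∂nu, M f t = (t : ℂ) * f t) :
    IsTriangularTruncation a (truncOp a R M) := by
  have hKm := fun j => (continuous_convKernel y j).measurable
  choose A hA using fun j => exists_isIntegralOperator (hKm j) (norm_convKernel_le y j)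
  choose B hB using fun j => exists_isIntegralOperator (measurable_truncKernel (hKm j))
    fun t s => (norm_truncKernel_le _ t s).trans (norm_convKernel_le y j t s)
  have hlim := tendsto_lambdaLogNorm_sub hy h0 hs (fun j => isDiag_convKernel hy h0 (hA j)) ha
  refine ⟨A, B, fun j => ⟨_, memLp_convKernel y j, hA j, hB j⟩, hlim, ?_⟩
  have hAa := tendsto_of_lambdaLogNorm hlim
  let S : ℕ → H →L[ℂ] H := fun j => (Real.pi : ℂ) • B j - (M * A j - A j * M)
  -- Both operators are diagonal in the Fourier basis, so the uniform error of the multipliers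
  -- bounds the norm of the difference.
  have hS : Tendsto S atTop (𝓝 R) := by
    rw [tendsto_iff_norm_sub_tendsto_zero]
    refine squeeze_zero (fun _ => norm_nonneg _) (fun j => ?_)
      (by simpa using (tendsto_tailNorm hy h0 hs).const_mul 3)
    have h := (isDiag_truncKernel_sub_commutator hy h0 hs (hA j) (hB j) hM).sub hR
    have h3 := fun m => abs_sum_sub_hilbert_le hy h0 hs m j
    refine h.norm_le ((abs_nonneg _).trans (h3 0)) fun m => ?_
    rw [← mul_sub, ← Complex.ofReal_sub, norm_mul, norm_neg, Complex.norm_I, one_mul,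
      Complex.norm_real]
    exact h3 m
  have hBS : ∀ j, B j = truncOp (A j) (S j) M := fun j => by
    have hpi : (Real.pi : ℂ) ≠ 0 := by exact_mod_cast Real.pi_ne_zero
    rw [truncOp, add_sub_cancel, smul_smul, inv_mul_cancel₀ hpi, one_smul]
  rw [show B = fun j => truncOp (A j) (S j) M from funext hBS]
  exact (((tendsto_const_nhds.mul hAa).sub (hAa.mul tendsto_const_nhds)).add hS).const_smul _

theorem calderon_le_opMu_truncOp (hy : Antitone y) (h0 : ∀ n, 0 ≤ y n)
    (hs : Summable fun n : ℕ => y n / ((n : ℝ) + 1)) {a R M : H →L[ℂ] H}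
    (ha : IsDiag fourierHilbertBasis (extend y) a)
    (hR : IsDiag fourierHilbertBasis (fun m => -Complex.I * (hilbert y m : ℝ)) R) (n : ℕ) :
    1 / (8 * Real.pi) * calderon y n ≤ opMu (truncOp a R M) n := by
  refine le_opMu_of_compression (b := fourierHilbertBasis)
    (α := fun m => (Real.pi : ℂ)⁻¹ * (-Complex.I * (hilbert y m : ℝ)))
    -- The `n + 1` negative frequencies nearest to zero: `a` vanishes on them and has no component
    -- along them, so `[M, a]` drops out, whatever `M` is.
    (Finset.Ico (-(n + 1 : ℤ)) 0) (by simp) (fun m hm => ?_) fun i hi j hj => ?_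
  · rw [Finset.mem_Ico] at hm
    have h := calderon_le_abs_hilbert hy h0 hs hm.2 hm.1
    have hpi := Real.pi_pos
    rw [norm_mul, norm_mul, norm_neg, Complex.norm_I, one_mul, norm_inv, Complex.norm_real,
      Complex.norm_real, Real.norm_of_nonneg hpi.le, Real.norm_eq_abs]
    calc 1 / (8 * Real.pi) * calderon y n ≤ 1 / (8 * Real.pi) * (4 * |hilbert y m|) := by gcongr
      _ = Real.pi⁻¹ * |hilbert y m| / 2 := by field_simp; ring
      -- A factor `2` is given away; the argument yields the constant `1 / (4π)`.
      _ ≤ Real.pi⁻¹ * |hilbert y m| := half_le_self (by positivity)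
  · rw [Finset.mem_Ico] at hi hj
    have hai : a (fourierHilbertBasis i) = 0 := by
      rw [ha.apply_basis, extend, if_neg (by omega), zero_smul]
    have haj : ∀ f, fourierHilbertBasis.repr (a f) j = 0 := fun f => by
      rw [ha, extend, if_neg (by omega), zero_mul]
    have hsplit : truncOp a R M (fourierHilbertBasis i) = (Real.pi : ℂ)⁻¹ •
        (M (a (fourierHilbertBasis i)) - a (M (fourierHilbertBasis i)) +
          R (fourierHilbertBasis i)) := rfl
    rw [hsplit, hai, map_zero, zero_sub, hR.apply_basis, map_smul, lp.coeFn_smul, Pi.smul_apply,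
      map_add, lp.coeFn_add, Pi.add_apply, map_neg, lp.coeFn_neg, Pi.neg_apply, haj, neg_zero,
      zero_add, map_smul, lp.coeFn_smul, Pi.smul_apply, smul_eq_mul, smul_eq_mul]
    ring

end Construction

end TriTrunc

end

/-- For every `x ∈ Λ_log(ℤ₊)` there is a bounded operator `a` on `L_2(-π, π)` with
`μ(a) = μ(x)`, whose triangular truncation `T(a)` exists (and is unique), and such that
`μ(T(a)) ≥ (1 / (8π)) S_d μ(x)`; below, `Ta` is the operator `T(a)`. -/
theorem theorem1 (x : ℕ → ℂ) (hx : TriTrunc.MemLambdaLog x) :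
    ∃ a : TriTrunc.H →L[ℂ] TriTrunc.H,
      (∀ n : ℕ, TriTrunc.opMu a n = TriTrunc.seqMu x n) ∧
      ∃ Ta : TriTrunc.H →L[ℂ] TriTrunc.H,
        (∀ b : TriTrunc.H →L[ℂ] TriTrunc.H,
          TriTrunc.IsTriangularTruncation a b ↔ b = Ta) ∧
        ∀ n : ℕ,
          1 / (8 * Real.pi) * TriTrunc.calderon (TriTrunc.seqMu x) n ≤ TriTrunc.opMu Ta n := by
  have hy := TriTrunc.antitone_seqMu hx.1
  have h0 := TriTrunc.seqMu_nonneg x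
  have hs := hx.2
  obtain ⟨a, ha⟩ := TriTrunc.exists_isDiag TriTrunc.fourierHilbertBasis
    (α := TriTrunc.extend (TriTrunc.seqMu x)) (C := TriTrunc.seqMu x 0)
    fun m => TriTrunc.norm_extend_le hy h0 (Nat.zero_le _)
  obtain ⟨R, hR⟩ := TriTrunc.exists_isDiag TriTrunc.fourierHilbertBasis
    (α := fun m => -Complex.I * (TriTrunc.hilbert (TriTrunc.seqMu x) m : ℝ))
    (C := 3 * TriTrunc.tailNorm (TriTrunc.seqMu x) 0) fun m => by
      rw [norm_mul, norm_neg, Complex.norm_I, one_mul, Complex.norm_real]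
      exact TriTrunc.abs_hilbert_le hy h0 hs m
  obtain ⟨M, hM⟩ := TriTrunc.exists_mul_id
  have hT := TriTrunc.isTriangularTruncation_truncOp hy h0 hs ha hR hM
  refine ⟨a, TriTrunc.opMu_eq_of_isDiag_extend hy h0 ha, TriTrunc.truncOp a R M, fun b => ?_,
    TriTrunc.calderon_le_opMu_truncOp hy h0 hs ha hR⟩
  exact ⟨fun h => h.unique hT, fun h => h ▸ hT⟩
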